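/- **Conventions.** All vector spaces are over $\mathbb R$. For a finite-dimensional vector space $V$ put $\mathfrak d(V)=\dim V$, $\lambda(V)=\Lambda^{\mathfrak d(V)}V$ (so $\lambda(0)=\mathbb R$) and $\lambda^*(V)=\lambda(V)^*$. For an isomorphism $f$ let $\lambda(f)$ be the induced map of top exterior powers. For a nonzero vector $y$ in a line $L$ let $y^*\in L^*$ be the functional with $y^*(y)=1$. For Banach spaces $X,Y$ let $\mathcal F(X,Y)$ be the space of Fredholm operators $D:X\to Y$ with the operator norm topology. For $D\in\mathcal F(X,Y)$ write $\kappa(D)=\ker D$, $\mathfrak c(D)=Y/\operatorname{Im}D$, $\operatorname{ind}D=\mathfrak d(\kappa(D))-\mathfrak d(\mathfrak c(D))$, $$\lambda(D)=\lambda(\kappa(D))\otimes\lambda^*(\mathfrak c(D)),\qquad \det\nolimits_{X,Y}=\bigsqcup_{D\in\mathcal F(X,Y)}\lambda(D)\longrightarrow\mathcal F(X,Y).$$ **Topology of $\det_{X,Y}$.** Let $N\ge 0$, let $\Theta:\mathbb R^N\to Y$ be linear, and put $D_\Theta:X\oplus\mathbb R^N\to Y$, $D_\Theta(x,u)=Dx+\Theta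 u$. If $D_\Theta$ is onto, let $Q=\{u\in\mathbb R^N:\Theta u\in\operatorname{Im}D\}$, let $\iota:\kappa(D)\to\kappa(D_\Theta)$, $\iota(x)=(x,0)$, let $\pi:\kappa(D_\Theta)\to Q$, $\pi(x,u)=u$, and let $\delta:\mathbb R^N\to\mathfrak c(D)$, $\delta(u)=\Theta u+\operatorname{Im}D$. There is an isomorphism $\mathcal I_{\Theta;D}:\lambda(D_\Theta)\to\lambda(D)$ with $$\mathcal I_{\Theta;D}\big((\lambda(\iota)x\wedge v)\otimes 1^*\big)=(-1)^{(\operatorname{ind}D_\Theta)N+N\,\mathfrak d(Q)}\;x\otimes(\lambda(\delta)w)^*$$ whenever $x\in\lambda(\kappa(D))$, $\lambda(\pi)v\wedge w=e_1\wedge\dots\wedge e_N$. (Here $v$, a wedge of $\mathfrak d(Q)$ elements of $\kappa(D_\Theta)$, and $w$, a wedge of $\mathfrak d(\mathfrak c(D))$ elements of $\mathbb R^N$, are mapped factor by factor.) Let further $E_0\in\mathcal F(X\oplus\mathbb R^N,Y)$ be onto with continuous linear right inverse $T$. For all $D$ in the open set $U$ where $D_\Theta$ is onto and $\Phi_D:\kappa(D_\Theta)\to\kappa(E_0)$,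 $\Phi_D(z)=z-TE_0z$, is an isomorphism, these data define a map $$U\times\lambda(E_0)\to\det\nolimits_{X,Y}|_U,\qquad (D,\sigma)\mapsto\mathcal I_{\Theta;D}\big((\lambda(\Phi_D)^{-1}\otimes\mathrm{id})\,\sigma\big).$$ A subset of $\det_{X,Y}$ is open if and only if its preimages under all of these maps (for all $N,\Theta,E_0,T$) are open; these maps are the local trivializations of the determinant line bundle $\det_{X,Y}$. **Dualization.** For $D\in\mathcal F(X,Y)$ let $D^*:Y^*\to X^*$, $D^*\alpha=\alpha\circ D$, be its transpose between the topological duals, and let $\mathcal D:\mathcal F(X,Y)\to\mathcal F(Y^*,X^*)$, $\mathcal D(D)=D^*$. There are isomorphisms $$\mathcal D_D:\kappa(D)\to\mathfrak c(D^*)^*,\quad(\mathcal D_Dx)(\alpha+\operatorname{Im}D^*)=\alpha(x),\qquad \mathcal D_D:\mathfrak c(D)^*\to\kappa(D^*),\quad(\mathcal D_D\beta)(y)=\beta(y+\operatorname{Im}D).$$ For $V$ of dimension $n<\infty$ let $\mathcal P:\lambda(V^*)\to\lambda^*(V)$ be the isomorphism $\mathcal P(\alpha_1\wedge\dots\wedge\alpha_n)(v_1\wedge\dots\wedge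 v_n)=(-1)^{\binom n2}\det(\alpha_i(v_j))$. Define the isomorphism $\widetilde{\mathcal D}_D:\lambda(D)\to\lambda(D^*)$ by $$\widetilde{\mathcal D}_D(x\otimes\alpha)=(-1)^{(\operatorname{ind}D)\,\mathfrak d(\mathfrak c(D))}\;\lambda(\mathcal D_D)(\mathcal P^{-1}\alpha)\otimes\mathcal P(\lambda(\mathcal D_D)x).$$ **Corollary.** Let $X,Y$ be Banach spaces. The isomorphisms $\widetilde{\mathcal D}_D$, $D\in\mathcal F(X,Y)$, induce a continuous bundle map $$\widetilde{\mathcal D}:\det\nolimits_{X,Y}\longrightarrow\mathcal D^*\det\nolimits_{Y^*,X^*}$$ over $\mathcal F(X,Y)$, where $\mathcal D^*\det_{Y^*,X^*}$ is the pullback bundle. -/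

import Mathlib

open scoped TensorProduct Bundle

noncomputable section

namespace FredDet

/-! ### Determinant lines of finite-dimensional vector spaces -/

section LinearAlgebra

variable {V W V' V'' : Type*} [AddCommGroup V] [Module ℝ V] [AddCommGroup W] [Module ℝ W]
  [AddCommGroup V'] [Module ℝ V'] [AddCommGroup V''] [Module ℝ V'']

/-- The top exterior power `λ(V)` of a (finite-dimensional) real vector space. -/
abbrev Top (V : Type*) [AddCommGroup V] [Module ℝ V] : Type _ :=
  ⋀[ℝ]^(Module.finrank ℝ V) V

/-- `⋀^m V = ⋀^n V` for `m = n`. -/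
def extCast (V : Type*) [AddCommGroup V] [Module ℝ V] {m n : ℕ} (h : m = n) :
    ⋀[ℝ]^m V ≃ₗ[ℝ] ⋀[ℝ]^n V :=
  LinearEquiv.ofEq _ _ (by rw [h])

/-- The isomorphism `⋀^n f : ⋀^n V → ⋀^n W` induced by an isomorphism `f : V → W`. -/
def extMapEquiv (n : ℕ) (f : V ≃ₗ[ℝ] W) : ⋀[ℝ]^n V ≃ₗ[ℝ] ⋀[ℝ]^n W :=
  LinearEquiv.ofLinearMap (exteriorPower.map n (f : V →ₗ[ℝ] W))
    (exteriorPower.map n (f.symm : W →ₗ[ℝ] V))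
    (by rw [← exteriorPower.map_comp]; simp)
    (by rw [← exteriorPower.map_comp]; simp)

/-- The isomorphism `λ(f) : λ(V) → λ(W)` induced by an isomorphism `f : V → W`, i.e.
`v₁ ∧ … ∧ vₙ ↦ f v₁ ∧ … ∧ f vₙ`. -/
def topMap (f : V ≃ₗ[ℝ] W) : Top V ≃ₗ[ℝ] Top W :=
  (extMapEquiv (Module.finrank ℝ V) f).trans (extCast W f.finrank_eq)

theorem finrank_top [FiniteDimensional ℝ V] : Module.finrank ℝ (Top V) = 1 := by
  rw [exteriorPower.finrank_eq, Nat.choose_self]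

/-- `0 → V' → V → V'' → 0` is exact. -/
structure ShortExact (i : V' →ₗ[ℝ] V) (j : V →ₗ[ℝ] V'') : Prop where
  inj : Function.Injective i
  surj : Function.Surjective j
  exact : Function.Exact i j

theorem ShortExact.finrank_eq [FiniteDimensional ℝ V] {i : V' →ₗ[ℝ] V} {j : V →ₗ[ℝ] V''}
    (h : ShortExact i j) :
    Module.finrank ℝ V' + Module.finrank ℝ V'' = Module.finrank ℝ V := by
  have h1 := LinearMap.finrank_range_add_finrank_ker j
  rw [LinearMap.range_eq_top.2 h.surj, _root_.finrank_top, h.exact.linearMap_ker_eq,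
    LinearMap.finrank_range_of_inj h.inj] at h1
  omega

/-- A linear section of the surjection in a short exact sequence. -/
def ShortExact.sec {i : V' →ₗ[ℝ] V} {j : V →ₗ[ℝ] V''} (h : ShortExact i j) : V'' →ₗ[ℝ] V :=
  (j.exists_rightInverse_of_surjective (LinearMap.range_eq_top.2 h.surj)).choose

theorem ShortExact.sec_spec {i : V' →ₗ[ℝ] V} {j : V →ₗ[ℝ] V''} (h : ShortExact i j) (x : V'') :
    j (h.sec x) = x :=
  LinearMap.congr_fun
    (j.exists_rightInverse_of_surjective (LinearMap.range_eq_top.2 h.surj)).choose_spec x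

/-- The exterior product `⋀^m V ⊗ ⋀^n V → ⋀^(m+n) V`. -/
def extMul (V : Type*) [AddCommGroup V] [Module ℝ V] (m n : ℕ) :
    ⋀[ℝ]^m V →ₗ[ℝ] ⋀[ℝ]^n V →ₗ[ℝ] ⋀[ℝ]^(m + n) V :=
  LinearMap.mk₂ ℝ
    (fun a b => ⟨(a : ExteriorAlgebra ℝ V) * b, SetLike.mul_mem_graded a.2 b.2⟩)
    (fun _ _ _ => Subtype.ext (by simp [add_mul])) (fun _ _ _ => Subtype.ext (by simp))
    (fun _ _ _ => Subtype.ext (by simp [mul_add])) (fun _ _ _ => Subtype.ext (by simp))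

/-- The linear map underlying `ShortExact.wedge`. -/
def ShortExact.wedgeHom [FiniteDimensional ℝ V] {i : V' →ₗ[ℝ] V} {j : V →ₗ[ℝ] V''}
    (h : ShortExact i j) : Top V' ⊗[ℝ] Top V'' →ₗ[ℝ] Top V :=
  (extCast V h.finrank_eq).toLinearMap ∘ₗ TensorProduct.lift ((extMul V _ _).compl₁₂
    (exteriorPower.map _ i) (exteriorPower.map _ h.sec))

theorem extMul_eq_of_lift [FiniteDimensional ℝ V] {i : V' →ₗ[ℝ] V} {j : V →ₗ[ℝ] V''}
    (h : ShortExact i j) {n : ℕ} (v' : Fin (Module.finrank ℝ V') → V') (v w : Fin n → V)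
    (hvw : ∀ k, j (v k) = j (w k)) :
    ExteriorAlgebra.ιMulti ℝ _ (i ∘ v') * ExteriorAlgebra.ιMulti ℝ n v =
      ExteriorAlgebra.ιMulti ℝ _ (i ∘ v') * ExteriorAlgebra.ιMulti ℝ n w := by
  classical
  have : FiniteDimensional ℝ V' := FiniteDimensional.of_injective i h.inj
  let f : V [⋀^Fin n]→ₗ[ℝ] ExteriorAlgebra ℝ V :=
    (LinearMap.mulLeft ℝ (ExteriorAlgebra.ιMulti ℝ _ (i ∘ v'))).compAlternatingMap
      (ExteriorAlgebra.ιMulti ℝ n)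
  have hf : ∀ u, f u = ExteriorAlgebra.ιMulti ℝ _ (Fin.append (i ∘ v') u) := fun u => by
    simp [f, ExteriorAlgebra.ιMulti_mul_ιMulti]
  have key : ∀ (u : Fin n → V) (k : Fin n), j (u k) = 0 → f u = 0 := by
    intro u k hk
    rw [hf]
    apply AlternatingMap.map_linearDependent
    intro hli
    obtain ⟨a, ha⟩ := (h.exact _).1 hk
    have hli' : LinearIndependent ℝ v' := by
      have := hli.comp (Fin.castAdd n) (Fin.castAdd_injective _ _)
      have h2 : (Fin.append (i ∘ v') u) ∘ Fin.castAdd n = i ∘ v' := by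
        ext m; simp
      rw [h2] at this
      exact LinearIndependent.of_comp i this
    have hsp : Submodule.span ℝ (Set.range v') = ⊤ :=
      hli'.span_eq_top_of_card_eq_finrank' (by simp)
    have hmem : u k ∈ Submodule.span ℝ
        (Fin.append (i ∘ v') u '' (Set.range (Fin.castAdd n))) := by
      have h3 : Fin.append (i ∘ v') u '' (Set.range (Fin.castAdd n)) = i '' Set.range v' := by
        rw [← Set.range_comp, ← Set.range_comp]
        congr 1
        ext m; simp
      rw [h3, ← Submodule.map_span, hsp, ← ha]
      exact ⟨a, trivial, rfl⟩
    have h4 := hli.notMem_span_image (s := Set.range (Fin.castAdd n))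
      (x := Fin.natAdd _ k) (by
        rintro ⟨m, hm⟩
        have := congrArg Fin.val hm
        simp at this
        omega)
    rw [Fin.append_right] at h4
    exact h4 hmem
  have step : ∀ s : Finset (Fin n), f (s.piecewise w v) = f v := by
    intro s
    induction s using Finset.induction_on with
    | empty => simp
    | insert k s hk ih =>
      rw [Finset.piecewise_insert, ← ih]
      have h5 := f.map_update_sub (s.piecewise w v) k (w k) ((s.piecewise w v) k)
      rw [Function.update_eq_self] at h5
      have h6 : f (Function.update (s.piecewise w v) k (w k - (s.piecewise w v) k)) = 0 := by
        apply key _ k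
        simp [hk, hvw]
      rw [h6] at h5
      exact (sub_eq_zero.1 h5.symm)
  have := step Finset.univ
  rw [Finset.piecewise_univ] at this
  exact this.symm

/-- The defining formula
`(v'₁ ∧ … ∧ v'ₖ) ⊗ (j v₁ ∧ … ∧ j vₗ) ↦ i v'₁ ∧ … ∧ i v'ₖ ∧ v₁ ∧ … ∧ vₗ`;
in particular the map does not depend on the section used to define it. -/
theorem ShortExact.wedgeHom_apply [FiniteDimensional ℝ V] {i : V' →ₗ[ℝ] V} {j : V →ₗ[ℝ] V''}
    (h : ShortExact i j) (v' : Fin (Module.finrank ℝ V') → V')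
    (v : Fin (Module.finrank ℝ V'') → V) :
    ((h.wedgeHom (exteriorPower.ιMulti ℝ _ v' ⊗ₜ exteriorPower.ιMulti ℝ _ (j ∘ v)) : Top V) :
      ExteriorAlgebra ℝ V) = ExteriorAlgebra.ιMulti ℝ _ (Fin.append (i ∘ v') v) := by
  rw [← ExteriorAlgebra.ιMulti_mul_ιMulti,
    extMul_eq_of_lift h v' v (h.sec ∘ j ∘ v) (fun k => by simp [h.sec_spec])]
  simp [ShortExact.wedgeHom, extMul, extCast, exteriorPower.map_apply_ιMulti]

theorem ShortExact.wedgeHom_bijective [FiniteDimensional ℝ V] {i : V' →ₗ[ℝ] V}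
    {j : V →ₗ[ℝ] V''} (h : ShortExact i j) : Function.Bijective h.wedgeHom := by
  have : FiniteDimensional ℝ V' := FiniteDimensional.of_injective i h.inj
  have : FiniteDimensional ℝ V'' := Module.Finite.of_surjective j h.surj
  have : IsSimpleModule ℝ (Top V) := isSimpleModule_iff_finrank_eq_one.2 finrank_top
  have : IsSimpleModule ℝ (Top V' ⊗[ℝ] Top V'') := isSimpleModule_iff_finrank_eq_one.2 (by
    rw [Module.finrank_tensorProduct, finrank_top, finrank_top])
  refine LinearMap.bijective_of_ne_zero (R := ℝ) (M := Top V' ⊗[ℝ] Top V'') (N := Top V)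
    (f := h.wedgeHom) ?_
  intro h0
  let b' := Module.finBasis ℝ V'
  let b'' := Module.finBasis ℝ V''
  have h1 := h.wedgeHom_apply b' (h.sec ∘ b'')
  rw [h0] at h1
  have hli : LinearIndependent ℝ (Fin.append (i ∘ b') (h.sec ∘ b'')) := by
    rw [← linearIndependent_equiv finSumFinEquiv]
    have h2 : Fin.append (i ∘ b') (h.sec ∘ b'') ∘ finSumFinEquiv
        = Sum.elim (i ∘ b') (h.sec ∘ b'') := by
      ext m; rcases m with m | m <;> simp
    rw [h2]
    refine LinearIndependent.sum_type
      (b'.linearIndependent.map' i (LinearMap.ker_eq_bot.2 h.inj)) ?_ ?_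
    · refine b''.linearIndependent.map' h.sec (LinearMap.ker_eq_bot.2 ?_)
      exact Function.LeftInverse.injective h.sec_spec
    · rw [Submodule.disjoint_def]
      intro x hx hx'
      rw [Set.range_comp, ← Submodule.map_span] at hx hx'
      obtain ⟨a, -, rfl⟩ := hx
      obtain ⟨c, -, hc⟩ := hx'
      have h3 : j (i a) = 0 := (h.exact _).2 ⟨a, rfl⟩
      rw [← hc, h.sec_spec] at h3
      rw [← hc, h3, map_zero]
  let b := basisOfLinearIndependentOfCardEqFinrank' _ hli (by simp [h.finrank_eq])
  have hb : (b : _ → V) = Fin.append (i ∘ b') (h.sec ∘ b'') := by simp [b]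
  have h4 : exteriorPower.ιMulti ℝ _ b = (0 : ⋀[ℝ]^_ V) := by
    apply Subtype.ext
    rw [hb, exteriorPower.ιMulti_apply_coe, ← h1]
    rfl
  have h5 := congrArg (exteriorPower.alternatingMapLinearEquiv b.det) h4
  rw [exteriorPower.alternatingMapLinearEquiv_apply_ιMulti, b.det_self, map_zero] at h5
  exact one_ne_zero h5

/-- The natural isomorphism `∧_V : λ(V') ⊗ λ(V'') → λ(V)` of a short exact sequence
`0 → V' → V → V'' → 0`; see `ShortExact.wedgeHom_apply` for the formula. -/
def ShortExact.wedge [FiniteDimensional ℝ V] {i : V' →ₗ[ℝ] V} {j : V →ₗ[ℝ] V''}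
    (h : ShortExact i j) : Top V' ⊗[ℝ] Top V'' ≃ₗ[ℝ] Top V :=
  LinearEquiv.ofBijective h.wedgeHom h.wedgeHom_bijective

theorem pairingDual_ne_zero (V : Type*) [AddCommGroup V] [Module ℝ V] [FiniteDimensional ℝ V] :
    exteriorPower.pairingDual ℝ V (Module.finrank ℝ V) ≠ 0 := by
  intro h
  let b := Module.finBasis ℝ V
  have h1 := exteriorPower.pairingDual_apply_apply_eq_one b b.coord (by simp)
    (fun i j hij => by simp [hij.symm]) (Module.finrank ℝ V) (OrderIso.refl _).toOrderEmbedding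
  rw [h] at h1
  simp at h1

/-- The isomorphism `𝒫 : λ(V*) → λ*(V)`,
`𝒫(α₁ ∧ … ∧ αₙ)(v₁ ∧ … ∧ vₙ) = (-1)^(n choose 2) det (αᵢ(vⱼ))`; see `dualTop_apply`. -/
def dualTop (V : Type*) [AddCommGroup V] [Module ℝ V] [FiniteDimensional ℝ V] :
    Top (Module.Dual ℝ V) ≃ₗ[ℝ] Module.Dual ℝ (Top V) :=
  (extCast (Module.Dual ℝ V) Subspace.dual_finrank_eq).trans
    ((LinearEquiv.ofBijective (exteriorPower.pairingDual ℝ V (Module.finrank ℝ V)) (by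
      have : IsSimpleModule ℝ (Module.Dual ℝ (Top V)) :=
        isSimpleModule_iff_finrank_eq_one.2 (by rw [Subspace.dual_finrank_eq, finrank_top])
      have : IsSimpleModule ℝ (⋀[ℝ]^(Module.finrank ℝ V) (Module.Dual ℝ V)) :=
        isSimpleModule_iff_finrank_eq_one.2 (by
          rw [exteriorPower.finrank_eq, Subspace.dual_finrank_eq, Nat.choose_self])
      exact LinearMap.bijective_of_ne_zero (pairingDual_ne_zero V))).trans
    (LinearEquiv.smulOfNeZero ℝ _ ((-1 : ℝ) ^ (Module.finrank ℝ V).choose 2) (by simp)))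

theorem dualTop_apply (V : Type*) [AddCommGroup V] [Module ℝ V] [FiniteDimensional ℝ V]
    (α : Fin (Module.finrank ℝ V) → Module.Dual ℝ V) (v : Fin (Module.finrank ℝ V) → V) :
    dualTop V (extCast _ Subspace.dual_finrank_eq.symm (exteriorPower.ιMulti ℝ _ α))
        (exteriorPower.ιMulti ℝ _ v) =
      (-1 : ℝ) ^ (Module.finrank ℝ V).choose 2 * (Matrix.of fun i j => α i (v j)).det := by
  have h : extCast (Module.Dual ℝ V) Subspace.dual_finrank_eq
      (extCast _ Subspace.dual_finrank_eq.symm (exteriorPower.ιMulti ℝ _ α)) =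
      exteriorPower.ιMulti ℝ _ α := rfl
  rw [dualTop, LinearEquiv.trans_apply, h, ← Matrix.det_transpose]
  simp [exteriorPower.pairingDual_ιMulti_ιMulti, Matrix.transpose]

/-- The coordinate `λ(ℝᴺ) → ℝ` with `Ω_N = e₁ ∧ … ∧ e_N ↦ 1`. -/
def volCoord (N : ℕ) : Top (Fin N → ℝ) →ₗ[ℝ] ℝ :=
  exteriorPower.alternatingMapLinearEquiv (Pi.basisFun ℝ (Fin N)).det ∘ₗ
    (extCast (Fin N → ℝ) (Module.finrank_fin_fun ℝ)).toLinearMap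

/-- The evaluation `λ*(0) → ℝ`, `α ↦ α(1)`, of the dual of `λ(0) = ℝ`. -/
def evalOne {V : Type*} [AddCommGroup V] [Module ℝ V] (h : Module.finrank ℝ V = 0) :
    Module.Dual ℝ (Top V) →ₗ[ℝ] ℝ :=
  LinearMap.applyₗ (extCast V h.symm (exteriorPower.ιMulti ℝ 0 ![]))

end LinearAlgebra

/-! ### Fredholm operators and their duals -/

section Fredholm

variable {X Y : Type*} [NormedAddCommGroup X] [NormedSpace ℝ X] [NormedAddCommGroup Y]
  [NormedSpace ℝ Y]

/-- The space `F(X, Y)` of Fredholm operators, with the topology induced by the operator norm. -/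
abbrev Fred (X Y : Type*) [NormedAddCommGroup X] [NormedSpace ℝ X] [NormedAddCommGroup Y]
    [NormedSpace ℝ Y] : Type _ :=
  {D : X →L[ℝ] Y // D.IsFredholm}

/-- The kernel `κ(D)`. -/
abbrev Fred.Ker (D : Fred X Y) : Type _ := D.1.ker

/-- The cokernel `c(D) = Y / Im D`. -/
abbrev Fred.Coker (D : Fred X Y) : Type _ := Y ⧸ D.1.range

instance (D : Fred X Y) : FiniteDimensional ℝ D.Ker := D.2.finite_ker

instance (D : Fred X Y) : FiniteDimensional ℝ D.Coker := by
  have := D.2.finite_coker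
  infer_instance

/-- The index of a Fredholm operator. -/
def Fred.ind (D : Fred X Y) : ℤ := Module.finrank ℝ D.Ker - Module.finrank ℝ D.Coker

/-- The transpose `Y* → X*`, `α ↦ α ∘ D`. -/
abbrev transpose (D : X →L[ℝ] Y) : StrongDual ℝ Y →L[ℝ] StrongDual ℝ X :=
  ContinuousLinearMap.precomp ℝ D

theorem hasFiniteRange_transpose {D : X →L[ℝ] Y} (h : D.toLinearMap.HasFiniteRange) :
    (transpose D).toLinearMap.HasFiniteRange := by
  have : FiniteDimensional ℝ D.range := Module.Finite.of_fg h
  have h1 : (transpose D).toLinearMap =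
      (transpose D.rangeRestrict).toLinearMap ∘ₗ (transpose D.range.subtypeL).toLinearMap := by
    ext α x
    rfl
  have : FiniteDimensional ℝ (StrongDual ℝ D.range) := inferInstance
  rw [h1]
  exact LinearMap.HasFiniteRange.comp_right LinearMap.HasFiniteRange.of_finite_dom _

open scoped LinearMap.FiniteRangeSetoid in
theorem isFredholm_transpose {D : X →L[ℝ] Y} (h : D.IsFredholm) :
    (transpose D).IsFredholm := by
  obtain ⟨v, hv₁, hv₂⟩ := ContinuousLinearMap.isFredholm_iff_exists_isQuasiInverse.1 h
  refine ContinuousLinearMap.IsFredholm.of_isQuasiInverse (v := transpose v) ⟨?_, ?_⟩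
  · have h1 : (D ∘L v - .id ℝ Y).toLinearMap.HasFiniteRange :=
      LinearMap.FiniteRangeSetoid.equiv_iff_hasFiniteRange.1 hv₂
    exact LinearMap.FiniteRangeSetoid.equiv_iff_hasFiniteRange.2 (by
      refine (congrArg LinearMap.HasFiniteRange ?_).mpr (hasFiniteRange_transpose h1)
      apply LinearMap.ext
      intro α
      apply ContinuousLinearMap.ext
      intro x
      exact (map_sub α _ _).symm)
  · have h1 : (v ∘L D - .id ℝ X).toLinearMap.HasFiniteRange :=
      LinearMap.FiniteRangeSetoid.equiv_iff_hasFiniteRange.1 hv₁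
    exact LinearMap.FiniteRangeSetoid.equiv_iff_hasFiniteRange.2 (by
      refine (congrArg LinearMap.HasFiniteRange ?_).mpr (hasFiniteRange_transpose h1)
      apply LinearMap.ext
      intro α
      apply ContinuousLinearMap.ext
      intro x
      exact (map_sub α _ _).symm)

/-- The dualization map `𝒟 : F(X, Y) → F(Y*, X*)`, `D ↦ D*`. -/
def Fred.dual (D : Fred X Y) : Fred (StrongDual ℝ Y) (StrongDual ℝ X) :=
  ⟨transpose D.1, isFredholm_transpose D.2⟩

/-- The isomorphism `𝒟_D : c(D)* → κ(D*)`, `(𝒟_D β)(y) = β(y + Im D)`. -/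
def Fred.dualCoker (D : Fred X Y) : Module.Dual ℝ D.Coker ≃ₗ[ℝ] D.dual.Ker where
  toFun β := ⟨⟨β ∘ₗ D.1.range.mkQ, by
    have : IsClosed (D.1.range : Set Y) := D.2.isClosed_range
    have : T3Space D.Coker := Submodule.t3_quotient_of_isClosed _
    exact (LinearMap.continuous_of_finiteDimensional β).comp continuous_quot_mk⟩, by
    ext x
    have h : D.1.range.mkQ (D.1 x) = 0 := by simp
    change β (D.1.range.mkQ (D.1 x)) = 0
    rw [h, map_zero]⟩
  map_add' _ _ := rfl
  map_smul' _ _ := rfl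
  invFun α := D.1.range.liftQ (α.1 : Y →ₗ[ℝ] ℝ) (by
    rintro _ ⟨x, rfl⟩
    exact congrArg (fun f : StrongDual ℝ X => f x) α.2)
  left_inv β := by
    ext y
    rfl
  right_inv α := by
    ext y
    rfl

/-- The linear map underlying `Fred.dualKer`. -/
def Fred.dualKerHom (D : Fred X Y) : D.Ker →ₗ[ℝ] Module.Dual ℝ D.dual.Coker where
  toFun x := D.dual.1.range.liftQ
    (ContinuousLinearMap.apply ℝ ℝ (x : X) : StrongDual ℝ X →L[ℝ] ℝ).toLinearMap (by
      rintro _ ⟨α, rfl⟩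
      change α (D.1 x) = 0
      have h : D.1 x = 0 := x.2
      rw [h, map_zero])
  map_add' x y := by
    ext α
    exact map_add α (x : X) (y : X)
  map_smul' c x := by
    ext α
    exact map_smul α c (x : X)

theorem Fred.dualKerHom_bijective (D : Fred X Y) : Function.Bijective D.dualKerHom := by
  have hinj : Function.Injective D.dualKerHom := by
    rw [injective_iff_map_eq_zero]
    intro x hx
    apply Subtype.ext
    rw [Submodule.coe_zero, SeparatingDual.eq_zero_iff_forall_dual_eq_zero (R := ℝ)]
    intro α
    exact LinearMap.congr_fun hx (D.dual.1.range.mkQ α)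
  refine ⟨hinj, (LinearMap.injective_iff_surjective_of_finrank_eq_finrank
    (le_antisymm (LinearMap.finrank_le_finrank_of_injective hinj) ?_)).1 hinj⟩
  rw [Subspace.dual_finrank_eq, ← Subspace.dual_finrank_eq (K := ℝ) (V := D.Ker)]
  let r : StrongDual ℝ X →ₗ[ℝ] Module.Dual ℝ D.Ker :=
    D.1.ker.subtype.dualMap ∘ₗ ContinuousLinearMap.coeLM ℝ
  refine LinearMap.finrank_le_finrank_of_injective (f := D.dual.1.range.liftQ r ?_) ?_
  · rintro _ ⟨β, rfl⟩
    ext x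
    change β (D.1 x) = 0
    have h : D.1 x = 0 := x.2
    rw [h, map_zero]
  · rw [← LinearMap.ker_eq_bot, Submodule.ker_liftQ_eq_bot']
    apply le_antisymm
    · rintro _ ⟨β, rfl⟩
      ext x
      change β (D.1 x) = 0
      have h : D.1 x = 0 := x.2
      rw [h, map_zero]
    · intro α hα
      obtain ⟨P⟩ := D.2.nonempty_fredholmPackage
      refine ⟨α ∘L P.quasiInverse, ?_⟩
      ext x
      change α (P.quasiInverse (D.1 x)) = α x
      have hx : P.quasiInverse (D.1 x) - x ∈ D.1.ker := by
        change D.1 (P.quasiInverse (D.1 x) - x) = 0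
        rw [map_sub, sub_eq_zero]
        have hD : ∀ z, D.1 z = P.equiv (P.decDom.proj z) :=
          fun z => congrArg (fun f : X →L[ℝ] Y => f z) P.eq_equiv
        have hP : ∀ z, P.decDom.proj (P.decDom.proj z) = P.decDom.proj z :=
          fun z => Submodule.projectionOntoL_apply_left _ _
        rw [hD, hD]
        congr 2
        rw [← hP x]
        congr 2
        simp [ContinuousLinearMap.FredholmPackage.quasiInverse, FredholmDecomposition.proj]
      rw [← sub_eq_zero, ← map_sub]
      exact LinearMap.congr_fun hα ⟨_, hx⟩

/-- The isomorphism `𝒟_D : κ(D) → c(D*)*`, `(𝒟_D x)(α + Im D*) = α(x)`. -/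
def Fred.dualKer (D : Fred X Y) : D.Ker ≃ₗ[ℝ] Module.Dual ℝ D.dual.Coker :=
  LinearEquiv.ofBijective D.dualKerHom D.dualKerHom_bijective

/-! ### The determinant lines and the dualization isomorphisms -/

/-- The determinant line `λ(D) = λ(κ(D)) ⊗ λ*(c(D))` of a Fredholm operator, where
`λ*(V)` is the dual of `λ(V)`. -/
def DetLine (X Y : Type*) [NormedAddCommGroup X] [NormedSpace ℝ X] [NormedAddCommGroup Y]
    [NormedSpace ℝ Y] (D : Fred X Y) : Type _ :=
  Top D.Ker ⊗[ℝ] Module.Dual ℝ (Top D.Coker)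

instance (D : Fred X Y) : AddCommGroup (DetLine X Y D) :=
  inferInstanceAs (AddCommGroup (Top D.Ker ⊗[ℝ] Module.Dual ℝ (Top D.Coker)))

instance (D : Fred X Y) : Module ℝ (DetLine X Y D) :=
  inferInstanceAs (Module ℝ (Top D.Ker ⊗[ℝ] Module.Dual ℝ (Top D.Coker)))

/-- `λ(D)` is one-dimensional; it carries its unique vector space topology. -/
instance (D : Fred X Y) : TopologicalSpace (DetLine X Y D) := moduleTopology ℝ _

instance (D : Fred X Y) : IsModuleTopology ℝ (DetLine X Y D) := ⟨rfl⟩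

theorem finrank_detLine (D : Fred X Y) : Module.finrank ℝ (DetLine X Y D) = 1 := by
  change Module.finrank ℝ (Top D.Ker ⊗[ℝ] Module.Dual ℝ (Top D.Coker)) = 1
  rw [Module.finrank_tensorProduct, Subspace.dual_finrank_eq, finrank_top, finrank_top]

/-- The vector `x ⊗ α` in `λ(D)`. -/
def DetLine.tmul (D : Fred X Y) (x : Top D.Ker) (α : Module.Dual ℝ (Top D.Coker)) :
    DetLine X Y D :=
  TensorProduct.tmul ℝ x α

/-- The dualization isomorphism `𝒟̃_D : λ(D) → λ(D*)`,
`x ⊗ α ↦ (-1)^((ind D) dim c(D)) λ(𝒟_D)(𝒫⁻¹ α) ⊗ 𝒫(λ(𝒟_D) x)`. -/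
def dualIso (D : Fred X Y) :
    DetLine X Y D ≃ₗ[ℝ] DetLine (StrongDual ℝ Y) (StrongDual ℝ X) D.dual :=
  ((TensorProduct.comm ℝ (Top D.Ker) (Module.Dual ℝ (Top D.Coker))).trans
    (TensorProduct.congr ((dualTop D.Coker).symm.trans (topMap D.dualCoker))
      ((topMap D.dualKer).trans (dualTop D.dual.Coker)))).trans
    (LinearEquiv.smulOfNeZero ℝ (DetLine (StrongDual ℝ Y) (StrongDual ℝ X) D.dual)
      ((-1 : ℝ) ^ (D.ind * Module.finrank ℝ D.Coker)) (zpow_ne_zero _ (by norm_num)))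

theorem dualIso_tmul (D : Fred X Y) (x : Top D.Ker) (α : Module.Dual ℝ (Top D.Coker)) :
    dualIso D (.tmul D x α) = (-1 : ℝ) ^ (D.ind * Module.finrank ℝ D.Coker) •
      .tmul D.dual (topMap D.dualCoker ((dualTop D.Coker).symm α))
        (dualTop D.dual.Coker (topMap D.dualKer x)) :=
  rfl

/-! ### Stabilizations -/

open scoped LinearMap.FiniteRangeSetoid in
theorem isFredholm_coprod {D : X →L[ℝ] Y} (h : D.IsFredholm) {N : ℕ}
    (Θ : (Fin N → ℝ) →L[ℝ] Y) : (D.coprod Θ).IsFredholm := by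
  obtain ⟨v, hv⟩ := ContinuousLinearMap.isFredholm_iff_exists_isQuasiInverse.1 h
  have h1 : (LinearMap.inl ℝ X (Fin N → ℝ)).IsQuasiInverse
      (LinearMap.fst ℝ X (Fin N → ℝ)) := by
    constructor
    · refine LinearMap.FiniteRangeSetoid.equiv_iff_hasFiniteRange.2 ?_
      have h2 : LinearMap.inl ℝ X (Fin N → ℝ) ∘ₗ LinearMap.fst ℝ X (Fin N → ℝ) - LinearMap.id =
          -(LinearMap.inr ℝ X (Fin N → ℝ) ∘ₗ LinearMap.snd ℝ X (Fin N → ℝ)) := by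
        ext <;> simp
      rw [h2]
      exact (LinearMap.HasFiniteRange.comp_right .of_finite_dom _).neg
    · exact Setoid.refl _
  refine ContinuousLinearMap.IsFredholm.of_isQuasiInverse
    (v := (ContinuousLinearMap.inl ℝ X (Fin N → ℝ)).comp v) ?_
  refine (h1.comp hv).congr (Setoid.refl _) ?_
  refine LinearMap.FiniteRangeSetoid.equiv_iff_hasFiniteRange.2 ?_
  have h3 : (D.coprod Θ).toLinearMap - D.toLinearMap ∘ₗ LinearMap.fst ℝ X (Fin N → ℝ) =
      Θ.toLinearMap ∘ₗ LinearMap.snd ℝ X (Fin N → ℝ) := by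
    ext <;> simp
  rw [h3]
  exact LinearMap.HasFiniteRange.comp_right .of_finite_dom _

/-- The stabilization `D_Θ : X ⊕ ℝᴺ → Y`, `D_Θ(x, u) = D x + Θ u`. -/
def Fred.stab (D : Fred X Y) {N : ℕ} (Θ : (Fin N → ℝ) →L[ℝ] Y) : Fred (X × (Fin N → ℝ)) Y :=
  ⟨D.1.coprod Θ, isFredholm_coprod D.2 Θ⟩

variable {D : Fred X Y} {N : ℕ} {Θ : (Fin N → ℝ) →L[ℝ] Y}

theorem Fred.stab_apply (D : Fred X Y) (Θ : (Fin N → ℝ) →L[ℝ] Y) (z : X × (Fin N → ℝ)) :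
    (D.stab Θ).1 z = D.1 z.1 + Θ z.2 :=
  rfl

/-- `δ : ℝᴺ → c(D)`, `u ↦ Θ u + Im D`. -/
def Fred.toCoker (D : Fred X Y) (Θ : (Fin N → ℝ) →L[ℝ] Y) : (Fin N → ℝ) →ₗ[ℝ] D.Coker :=
  D.1.range.mkQ ∘ₗ Θ.toLinearMap

/-- The inclusion `κ(D) → κ(D_Θ)`, `x ↦ (x, 0)`. -/
def Fred.kerIncl (D : Fred X Y) (Θ : (Fin N → ℝ) →L[ℝ] Y) : D.Ker →ₗ[ℝ] (D.stab Θ).Ker :=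
  (LinearMap.inl ℝ X (Fin N → ℝ) ∘ₗ D.1.ker.subtype).codRestrict _ (fun x => by
    have h : D.1 x = 0 := x.2
    change D.1 x + Θ 0 = 0
    rw [h, map_zero, add_zero])

/-- The projection `κ(D_Θ) → Q`, `(x, u) ↦ u`, where `Q` is the kernel of `ℝᴺ → c(D)`. -/
def Fred.kerProj (D : Fred X Y) (Θ : (Fin N → ℝ) →L[ℝ] Y) :
    (D.stab Θ).Ker →ₗ[ℝ] (D.toCoker Θ).ker :=
  (LinearMap.snd ℝ X (Fin N → ℝ) ∘ₗ (D.stab Θ).1.ker.subtype).codRestrict _ (fun z => by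
    have h : D.1 z.1.1 + Θ z.1.2 = 0 := z.2
    change D.1.range.mkQ (Θ z.1.2) = 0
    rw [Submodule.mkQ_apply, Submodule.Quotient.mk_eq_zero, eq_neg_of_add_eq_zero_right h]
    exact neg_mem ⟨z.1.1, rfl⟩)

theorem Fred.shortExact_ker (D : Fred X Y) (Θ : (Fin N → ℝ) →L[ℝ] Y) :
    ShortExact (D.kerIncl Θ) (D.kerProj Θ) where
  inj x y h := by
    apply Subtype.ext
    exact congrArg (fun z : (D.stab Θ).Ker => z.1.1) h
  surj u := by
    have h : D.1.range.mkQ (Θ u.1) = 0 := u.2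
    rw [Submodule.mkQ_apply, Submodule.Quotient.mk_eq_zero] at h
    obtain ⟨x, hx⟩ := h
    refine ⟨⟨(-x, u.1), ?_⟩, rfl⟩
    change D.1 (-x) + Θ u.1 = 0
    rw [map_neg, neg_add_eq_zero]
    exact hx
  exact z := by
    constructor
    · intro h
      have h2 : z.1.2 = 0 := congrArg Subtype.val h
      have h3 : D.1 z.1.1 + Θ z.1.2 = 0 := z.2
      refine ⟨⟨z.1.1, ?_⟩, Subtype.ext (Prod.ext rfl h2.symm)⟩
      rw [h2, map_zero, add_zero] at h3
      exact h3
    · rintro ⟨x, rfl⟩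
      rfl

theorem Fred.shortExact_coker (h : Function.Surjective (D.stab Θ).1) :
    ShortExact (D.toCoker Θ).ker.subtype (D.toCoker Θ) where
  inj := Subtype.val_injective
  surj c := by
    obtain ⟨y, rfl⟩ := D.1.range.mkQ_surjective c
    obtain ⟨z, rfl⟩ := h y
    refine ⟨z.2, ?_⟩
    change D.1.range.mkQ (Θ z.2) = D.1.range.mkQ (D.1 z.1 + Θ z.2)
    have h0 : D.1.range.mkQ (D.1 z.1) = 0 := by simp
    rw [map_add, h0, zero_add]
  exact u := ⟨fun hu => ⟨⟨u, hu⟩, rfl⟩, by rintro ⟨v, rfl⟩; exact v.2⟩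

theorem Fred.subsingleton_coker {E : Fred X Y} (h : Function.Surjective E.1) :
    Subsingleton E.Coker :=
  Submodule.Quotient.subsingleton_iff.2 (LinearMap.range_eq_top.2 h)

/-- The isomorphism `λ(E) → λ(κ(E))`, `w ⊗ α ↦ α(1) w`, for a surjective Fredholm operator `E`. -/
def detSurj {E : Fred X Y} (h : Function.Surjective E.1) : DetLine X Y E →ₗ[ℝ] Top E.Ker :=
  TensorProduct.rid ℝ (Top E.Ker) ∘ₗ (evalOne (by
    have := Fred.subsingleton_coker h
    exact Module.finrank_zero_of_subsingleton)).lTensor (Top E.Ker)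

/-- For `v ∈ λ(Q)`, the functional on `λ(c(D))` sending `λ(δ) w` to the coefficient of
`v ∧ w` with respect to `Ω_N`; that is, the dual vector `(λ(δ) w)*` if `v ∧ w = Ω_N`. -/
def contract (h : Function.Surjective (D.stab Θ).1) :
    Top (D.toCoker Θ).ker →ₗ[ℝ] Module.Dual ℝ (Top D.Coker) :=
  TensorProduct.curry (volCoord N ∘ₗ (Fred.shortExact_coker h).wedge.toLinearMap)

/-- The exponent
`(ind D_Θ) N + (N + dim c(D_Θ)) dim Q`. -/
def stabSign (D : Fred X Y) (Θ : (Fin N → ℝ) →L[ℝ] Y) : ℤ :=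
  (D.stab Θ).ind * N +
    (N + Module.finrank ℝ (D.stab Θ).Coker) * Module.finrank ℝ (D.toCoker Θ).ker

/-- The isomorphism `ℐ_{Θ;D} : λ(D_Θ) → λ(D)` for surjective `D_Θ`:
`(λ(ι)x ∧ v) ⊗ 1* ↦ (-1)^ε x ⊗ (λ(δ) w)*` if `v ∧ w = Ω_N`. -/
def stabMap (h : Function.Surjective (D.stab Θ).1) :
    DetLine (X × (Fin N → ℝ)) Y (D.stab Θ) →ₗ[ℝ] DetLine X Y D :=
  (-1 : ℝ) ^ stabSign D Θ •
    ((contract h).lTensor (Top D.Ker) ∘ₗ (D.shortExact_ker Θ).wedge.symm.toLinearMap ∘ₗ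
      detSurj h : _ →ₗ[ℝ] Top D.Ker ⊗[ℝ] Module.Dual ℝ (Top D.Coker))

/-! ### The topology of the determinant line bundle -/

/-- The data of a local trivialization of the determinant line bundle: a map `Θ : ℝᴺ → Y` and
a Fredholm operator `E₀ : X ⊕ ℝᴺ → Y` with a right inverse `T`. -/
structure Chart (X Y : Type*) [NormedAddCommGroup X] [NormedSpace ℝ X] [NormedAddCommGroup Y]
    [NormedSpace ℝ Y] where
  N : ℕ
  Θ : (Fin N → ℝ) →L[ℝ] Y
  E₀ : Fred (X × (Fin N → ℝ)) Y
  T : Y →L[ℝ] X × (Fin N → ℝ)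
  rightInv : ∀ y, E₀.1 (T y) = y

namespace Chart

variable (c : Chart X Y)

theorem surjective : Function.Surjective c.E₀.1 := fun y => ⟨c.T y, c.rightInv y⟩

/-- The map `Φ : κ(E) → κ(E₀)`, `z ↦ z - T (E₀ z)`. -/
def proj (E : Fred (X × (Fin c.N → ℝ)) Y) : E.Ker →ₗ[ℝ] c.E₀.Ker :=
  ((LinearMap.id - c.T.toLinearMap ∘ₗ c.E₀.1.toLinearMap) ∘ₗ E.1.ker.subtype).codRestrict _
    (fun z => by
      change c.E₀.1 (z.1 - c.T (c.E₀.1 z.1)) = 0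
      rw [map_sub, c.rightInv, sub_self])

/-- The open set of all `D` such that `D_Θ` is onto and `Φ : κ(D_Θ) → κ(E₀)` is an isomorphism. -/
def dom : Set (Fred X Y) :=
  {D | Function.Surjective (D.stab c.Θ).1 ∧ Function.Bijective (c.proj (D.stab c.Θ))}

/-- The isomorphism `λ(Φ)⁻¹ ⊗ id : λ(E₀) → λ(D_Θ)`. -/
def kerMap (D : c.dom) :
    DetLine (X × (Fin c.N → ℝ)) Y c.E₀ →ₗ[ℝ]
      DetLine (X × (Fin c.N → ℝ)) Y (D.1.stab c.Θ) :=
  have := Fred.subsingleton_coker c.surjective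
  have := Fred.subsingleton_coker D.2.1
  (TensorProduct.congr (topMap (LinearEquiv.ofBijective _ D.2.2)).symm
    (topMap (LinearEquiv.ofSubsingleton (D.1.stab c.Θ).Coker c.E₀.Coker)).dualMap).toLinearMap

/-- The local trivialization `(D, σ) ↦ ℐ_{Θ;D}((λ(Φ)⁻¹ ⊗ id) σ) ∈ λ(D)`. -/
def map (p : c.dom × DetLine (X × (Fin c.N → ℝ)) Y c.E₀) :
    Bundle.TotalSpace ℝ (DetLine X Y) :=
  ⟨p.1.1, stabMap p.1.2.1 (c.kerMap p.1 p.2)⟩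

end Chart

/-- The topology of the total space `det_{X,Y}` defined by the local trivializations: a set is
open if and only if its preimages under all `Chart.map` are open. -/
instance : TopologicalSpace (Bundle.TotalSpace ℝ (DetLine X Y)) :=
  ⨆ c : Chart X Y, TopologicalSpace.coinduced c.map inferInstance

end Fredholm

end FredDet
end

/-! The topology of the total space is coinduced by the charts, so it suffices to see that
dualization composed with a chart is continuous near each point.

Near that point `D_Θ` is completed to an isomorphism `A = (D_Θ, L) : X ⊕ ℝᴺ → Y ⊕ ℝᵏ` with `k = dim
κ(D_Θ)`. With `ℝᵏ` and `ℝᴺ` regarded as self-dual, the transpose of `A` maps `Y* ⊕ ℝᵏ` to `X* ⊕ ℝᴺ`.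
Its `X*`-component is a stabilization of `D*` by `ℝᵏ`, hence onto, and its `ℝᴺ`-component gives
coordinates on the kernel of this stabilization. So one map `L` yields a frame of `κ(D_Θ)` and a
frame of the kernel of the stabilized transpose.

The core is `dualIso_stabTop`: dualization carries the vector of `λ(D)` defined by the first frame
to the vector of `λ(D*)` defined by the second, up to the sign `(-1)^(i(i-1)/2)` with `i = k - N =
ind D`. In bases adapted to the exact sequences for `D` and `D*`, the change-of-frame matrices are
inverse transposes of one another, so all determinants cancel (`dualIso_stabTop_aux`); the signs are
compared in `dual_sign_parity`.

The map `L` can be kept fixed while `D` varies, because invertibility is an open condition. The two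
frames then differ from those of the charts by determinants (`Chart.map_snd_eq`). These are
continuous in `D`, since the inverse of `Φ` is a restriction of the inverse of an operator depending
continuously on `D` (`Chart.continuous_kerEquiv_symm`). -/

namespace FredDet

/-! ### Wedges of explicit vectors in determinant lines. -/

section LinearAlgebra

variable {V W V' V'' : Type*} [AddCommGroup V] [Module ℝ V] [AddCommGroup W] [Module ℝ W]
  [AddCommGroup V'] [Module ℝ V'] [AddCommGroup V''] [Module ℝ V'']

/-- The element `v₁ ∧ … ∧ vₙ` of `λ(V)`, where `n = dim V`. -/
noncomputable def topOf {n : ℕ} (h : Module.finrank ℝ V = n) (v : Fin n → V) : Top V :=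
  extCast V h.symm (exteriorPower.ιMulti ℝ n v)

theorem coe_topOf {n : ℕ} (h : Module.finrank ℝ V = n) (v : Fin n → V) :
    (topOf h v : ExteriorAlgebra ℝ V) = ExteriorAlgebra.ιMulti ℝ n v :=
  rfl

theorem topMap_topOf (f : V ≃ₗ[ℝ] W) {n : ℕ} (h : Module.finrank ℝ V = n)
    (h' : Module.finrank ℝ W = n) (v : Fin n → V) :
    topMap f (topOf h v) = topOf h' (f ∘ v) := by
  subst h
  apply Subtype.ext
  change ((exteriorPower.map _ (f : V →ₗ[ℝ] W) (exteriorPower.ιMulti ℝ _ v) :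
    ⋀[ℝ]^_ W) : ExteriorAlgebra ℝ W) = _
  rw [exteriorPower.map_apply_ιMulti]
  rfl

theorem ShortExact.wedge_topOf [FiniteDimensional ℝ V] {i : V' →ₗ[ℝ] V} {j : V →ₗ[ℝ] V''}
    (h : ShortExact i j) {p r : ℕ} (hp : Module.finrank ℝ V' = p) (hr : Module.finrank ℝ V'' = r)
    (hk : Module.finrank ℝ V = p + r) (x : Fin p → V') (v : Fin r → V) :
    h.wedge (topOf hp x ⊗ₜ topOf hr (j ∘ v)) = topOf hk (Fin.append (i ∘ x) v) := by
  subst hp hr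
  exact Subtype.ext (h.wedgeHom_apply x v)

theorem topOf_basis_ne_zero {n : ℕ} (h : Module.finrank ℝ V = n)
    (b : Module.Basis (Fin n) ℝ V) : topOf h b ≠ 0 := by
  subst h
  intro h4
  have h5 := congrArg (exteriorPower.alternatingMapLinearEquiv b.det) h4
  rw [map_zero] at h5
  change exteriorPower.alternatingMapLinearEquiv b.det (exteriorPower.ιMulti ℝ _ b) = 0 at h5
  rw [exteriorPower.alternatingMapLinearEquiv_apply_ιMulti, b.det_self] at h5
  exact one_ne_zero h5

theorem topOf_eq_det_smul {n : ℕ} (h : Module.finrank ℝ V = n)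
    (b : Module.Basis (Fin n) ℝ V) (v : Fin n → V) : topOf h v = b.det v • topOf h b := by
  have h1 : (exteriorPower.ιMulti ℝ n : V [⋀^Fin n]→ₗ[ℝ] ⋀[ℝ]^n V) =
      (LinearMap.toSpanSingleton ℝ _ (exteriorPower.ιMulti ℝ n b)).compAlternatingMap b.det := by
    -- An alternating map is determined by its values on injective families of basis vectors; with
    -- `n` indices these are permutations of the basis, and both sides acquire the same sign.
    refine Module.Basis.ext_alternating b fun σ hσ => ?_
    let τ : Equiv.Perm (Fin n) := Equiv.ofBijective σ (Finite.injective_iff_bijective.1 hσ)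
    have h2 : (fun i => b (σ i)) = b ∘ τ := rfl
    rw [h2, AlternatingMap.map_perm, AlternatingMap.map_perm]
    simp [b.det_self]
  have h3 : exteriorPower.ιMulti ℝ n v = b.det v • exteriorPower.ιMulti ℝ n b := by
    conv_lhs => rw [h1]
    rfl
  rw [topOf, h3, map_smul, topOf]

theorem ιMulti_mul_ι (n : ℕ) (v : Fin n → V) (x : V) :
    ExteriorAlgebra.ιMulti ℝ n v * ExteriorAlgebra.ι ℝ x =
      (-1 : ℝ) ^ n • (ExteriorAlgebra.ι ℝ x * ExteriorAlgebra.ιMulti ℝ n v) := by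
  induction n with
  | zero => simp
  | succ n ih =>
    have h1 := eq_neg_of_add_eq_zero_left (ExteriorAlgebra.ι_add_mul_swap (R := ℝ) (v 0) x)
    rw [ExteriorAlgebra.ιMulti_succ_apply, mul_assoc, ih, mul_smul_comm, ← mul_assoc, h1,
      pow_succ, mul_neg_one, neg_smul, neg_mul, smul_neg, mul_assoc]

theorem ιMulti_mul_ιMulti_comm (m n : ℕ) (v : Fin m → V) (w : Fin n → V) :
    ExteriorAlgebra.ιMulti ℝ m v * ExteriorAlgebra.ιMulti ℝ n w =
      (-1 : ℝ) ^ (m * n) • (ExteriorAlgebra.ιMulti ℝ n w * ExteriorAlgebra.ιMulti ℝ m v) := by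
  induction n with
  | zero => simp
  | succ n ih =>
    rw [ExteriorAlgebra.ιMulti_succ_apply, ← mul_assoc, ιMulti_mul_ι, smul_mul_assoc, mul_assoc,
      ih, mul_smul_comm, smul_smul, ← pow_add, mul_assoc, Nat.mul_succ, add_comm m]

theorem topOf_append_comm {m n : ℕ} (h : Module.finrank ℝ V = m + n)
    (h' : Module.finrank ℝ V = n + m) (v : Fin m → V) (w : Fin n → V) :
    topOf h (Fin.append v w) = (-1 : ℝ) ^ (m * n) • topOf h' (Fin.append w v) := by
  apply Subtype.ext
  rw [Submodule.coe_smul, coe_topOf, coe_topOf, ← ExteriorAlgebra.ιMulti_mul_ιMulti,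
    ← ExteriorAlgebra.ιMulti_mul_ιMulti, ιMulti_mul_ιMulti_comm]

theorem volCoord_topOf {N : ℕ} (v : Fin N → Fin N → ℝ) :
    volCoord N (topOf (Module.finrank_fin_fun ℝ) v) = (Matrix.of v).det := by
  rw [← Matrix.det_transpose]
  change exteriorPower.alternatingMapLinearEquiv (Pi.basisFun ℝ (Fin N)).det
    (exteriorPower.ιMulti ℝ _ v) = _
  rw [exteriorPower.alternatingMapLinearEquiv_apply_ιMulti, Module.Basis.det_apply]
  rfl

theorem dualTop_topOf [FiniteDimensional ℝ V] {n : ℕ} (h : Module.finrank ℝ V = n)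
    (h' : Module.finrank ℝ (Module.Dual ℝ V) = n) (α : Fin n → Module.Dual ℝ V)
    (v : Fin n → V) :
    dualTop V (topOf h' α) (topOf h v) =
      (-1 : ℝ) ^ n.choose 2 * (Matrix.of fun i j => α i (v j)).det := by
  subst h
  exact dualTop_apply V α v

/-- Functionals on a determinant line are determined by their value at a nonzero vector. -/
theorem dual_top_ext [FiniteDimensional ℝ V] {φ ψ : Module.Dual ℝ (Top V)} {x : Top V}
    (hx : x ≠ 0) (h : φ x = ψ x) : φ = ψ := by
  refine LinearMap.ext fun y => ?_
  obtain ⟨c, rfl⟩ := (finrank_eq_one_iff_of_nonzero' x hx).1 finrank_top y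
  rw [map_smul, map_smul, h]

/-- The value of `𝒫` on the wedge of a dual family. -/
theorem smul_dualTop_topOf_of_dual [FiniteDimensional ℝ V] {n : ℕ}
    (h : Module.finrank ℝ V = n) (h' : Module.finrank ℝ (Module.Dual ℝ V) = n)
    {γ : Fin n → Module.Dual ℝ V} {c : Fin n → V} (hγ : ∀ i j, γ i (c j) = if i = j then 1 else 0)
    (α : Module.Dual ℝ (Top V)) :
    α (topOf h c) • dualTop V (topOf h' γ) = (-1 : ℝ) ^ n.choose 2 • α := by
  have h1 : dualTop V (topOf h' γ) (topOf h c) = (-1 : ℝ) ^ n.choose 2 := by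
    have : (Matrix.of fun i j => γ i (c j)) = 1 := by
      ext i j
      rw [Matrix.one_apply]
      exact hγ i j
    rw [dualTop_topOf, this, Matrix.det_one, mul_one]
  have hc : topOf h c ≠ 0 := by
    intro h0
    rw [h0, map_zero] at h1
    exact pow_ne_zero _ (by norm_num) h1.symm
  refine dual_top_ext hc ?_
  rw [LinearMap.smul_apply, h1, LinearMap.smul_apply, smul_eq_mul, smul_eq_mul, mul_comm]

theorem dualTop_symm_eq_of_dual [FiniteDimensional ℝ V] {n : ℕ}
    (h : Module.finrank ℝ V = n) (h' : Module.finrank ℝ (Module.Dual ℝ V) = n)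
    {γ : Fin n → Module.Dual ℝ V} {c : Fin n → V} (hγ : ∀ i j, γ i (c j) = if i = j then 1 else 0)
    (α : Module.Dual ℝ (Top V)) :
    (dualTop V).symm α = ((-1 : ℝ) ^ n.choose 2 * α (topOf h c)) • topOf h' γ := by
  rw [LinearEquiv.symm_apply_eq, LinearEquiv.map_smul, mul_smul,
    smul_dualTop_topOf_of_dual h h' hγ, smul_smul, ← mul_pow]
  norm_num

/-- The empty wedge generates `λ(0) = ℝ`, so some functional takes the value one on it. -/
theorem exists_evalOne_eq_one [FiniteDimensional ℝ V] (h : Module.finrank ℝ V = 0) :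
    ∃ α, evalOne h α = 1 := by
  have h0 := topOf_basis_ne_zero h (Module.finBasisOfFinrankEq ℝ V h)
  rw [topOf, Subsingleton.elim (⇑(Module.finBasisOfFinrankEq ℝ V h)) ![]] at h0
  exact Module.Projective.exists_dual_eq_one ℝ h0

theorem detBasis_equiv {n : ℕ} (e : V ≃ₗ[ℝ] (Fin n → ℝ)) (v : Fin n → V) :
    (Module.Basis.ofEquivFun e).det v = (Matrix.of fun i => e (v i)).det := by
  rw [← Matrix.det_transpose, Module.Basis.det_apply]
  rfl

end LinearAlgebra

/-! ### Stabilization and dualization on explicit wedges. -/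

section Fredholm

variable {X Y : Type*} [NormedAddCommGroup X] [NormedSpace ℝ X] [NormedAddCommGroup Y]
  [NormedSpace ℝ Y]

theorem detSurj_tmul {E : Fred X Y} (h : Function.Surjective E.1) (x : Top E.Ker)
    (α : Module.Dual ℝ (Top E.Coker)) :
    detSurj h (.tmul E x α) = evalOne (by
      have := Fred.subsingleton_coker h
      exact Module.finrank_zero_of_subsingleton) α • x :=
  rfl

theorem exists_detSurj_eq {E : Fred X Y} (h : Function.Surjective E.1) (x : Top E.Ker) :
    ∃ σ, detSurj h σ = x := by
  have := Fred.subsingleton_coker h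
  obtain ⟨α, hα⟩ := exists_evalOne_eq_one
    (Module.finrank_zero_of_subsingleton : Module.finrank ℝ E.Coker = 0)
  exact ⟨.tmul E x α, by rw [detSurj_tmul, hα, one_smul]⟩

theorem DetLine.tmul_smul (D : Fred X Y) (x : Top D.Ker) (c : ℝ)
    (α : Module.Dual ℝ (Top D.Coker)) : tmul D x (c • α) = c • tmul D x α :=
  TensorProduct.tmul_smul c x α

theorem DetLine.smul_tmul (D : Fred X Y) (x : Top D.Ker) (c : ℝ)
    (α : Module.Dual ℝ (Top D.Coker)) : tmul D (c • x) α = c • tmul D x α :=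
  TensorProduct.smul_tmul' c x α |>.symm

/-- The map `λ(κ(D_Θ)) → λ(D)` through which `stabMap` factors. -/
noncomputable def stabTop {D : Fred X Y} {N : ℕ} {Θ : (Fin N → ℝ) →L[ℝ] Y}
    (h : Function.Surjective (D.stab Θ).1) : Top (D.stab Θ).Ker →ₗ[ℝ] DetLine X Y D :=
  (-1 : ℝ) ^ stabSign D Θ •
    ((contract h).lTensor (Top D.Ker) ∘ₗ (D.shortExact_ker Θ).wedge.symm.toLinearMap :
      _ →ₗ[ℝ] Top D.Ker ⊗[ℝ] Module.Dual ℝ (Top D.Coker))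

theorem stabMap_eq {D : Fred X Y} {N : ℕ} {Θ : (Fin N → ℝ) →L[ℝ] Y}
    (h : Function.Surjective (D.stab Θ).1) (σ : DetLine (X × (Fin N → ℝ)) Y (D.stab Θ)) :
    stabMap h σ = stabTop h (detSurj h σ) :=
  rfl

theorem contract_topOf {D : Fred X Y} {r q : ℕ} {Θ : (Fin (r + q) → ℝ) →L[ℝ] Y}
    (h : Function.Surjective (D.stab Θ).1) (hr : Module.finrank ℝ (D.toCoker Θ).ker = r)
    (hq : Module.finrank ℝ D.Coker = q) (u : Fin r → (D.toCoker Θ).ker)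
    (w : Fin q → Fin (r + q) → ℝ) :
    contract h (topOf hr u) (topOf hq (D.toCoker Θ ∘ w)) =
      (Matrix.of (Fin.append (fun i => (u i).1) w)).det := by
  rw [← volCoord_topOf]
  exact congrArg (volCoord (r + q))
    ((Fred.shortExact_coker h).wedge_topOf hr hq (Module.finrank_fin_fun ℝ) u w)

theorem stabTop_topOf {D : Fred X Y} {N p r : ℕ} {Θ : (Fin N → ℝ) →L[ℝ] Y}
    (h : Function.Surjective (D.stab Θ).1) (hp : Module.finrank ℝ D.Ker = p)
    (hr : Module.finrank ℝ (D.toCoker Θ).ker = r)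
    (hk : Module.finrank ℝ (D.stab Θ).Ker = p + r) (x : Fin p → D.Ker)
    (v : Fin r → (D.stab Θ).Ker) :
    stabTop h (topOf hk (Fin.append (D.kerIncl Θ ∘ x) v)) =
      (-1 : ℝ) ^ stabSign D Θ •
        .tmul D (topOf hp x) (contract h (topOf hr (D.kerProj Θ ∘ v))) := by
  rw [← (D.shortExact_ker Θ).wedge_topOf hp hr hk]
  exact congrArg (fun t => (-1 : ℝ) ^ stabSign D Θ • (contract h).lTensor (Top D.Ker) t)
    ((D.shortExact_ker Θ).wedge.symm_apply_apply _)

/-- The family of functionals `x ↦ ⟨d, L(x, 0)⟩` on `X`, indexed by `d ∈ ℝᵏ`. -/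
noncomputable def dualFamily {N k : ℕ} (L : X × (Fin N → ℝ) →L[ℝ] (Fin k → ℝ)) :
    (Fin k → ℝ) →L[ℝ] StrongDual ℝ X :=
  LinearMap.toContinuousLinearMap
    (∑ i, (LinearMap.proj i : (Fin k → ℝ) →ₗ[ℝ] ℝ).smulRight
      (ContinuousLinearMap.proj i ∘L L ∘L ContinuousLinearMap.inl ℝ X (Fin N → ℝ)))

theorem dualFamily_apply {N k : ℕ} (L : X × (Fin N → ℝ) →L[ℝ] (Fin k → ℝ)) (d : Fin k → ℝ)
    (x : X) : dualFamily L d x = d ⬝ᵥ L (x, 0) := by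
  simp [dualFamily, dotProduct]

theorem stab_dual_ker_apply {D : Fred X Y} {N k : ℕ}
    {L : X × (Fin N → ℝ) →L[ℝ] (Fin k → ℝ)} (ζ : (D.dual.stab (dualFamily L)).Ker) (x : X) :
    ζ.1.1 (D.1 x) + ζ.1.2 ⬝ᵥ L (x, 0) = 0 := by
  have h : D.dual.1 ζ.1.1 + dualFamily L ζ.1.2 = 0 := ζ.2
  have h1 := congrArg (fun f : StrongDual ℝ X => f x) h
  rw [← dualFamily_apply]
  exact h1

/-- The pairing of `κ(D_Θ)` with the kernel of the stabilized transpose. -/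
theorem dotProduct_stab_ker {D : Fred X Y} {N k : ℕ} {Θ : (Fin N → ℝ) →L[ℝ] Y}
    {L : X × (Fin N → ℝ) →L[ℝ] (Fin k → ℝ)} {a : Fin N → ℝ}
    (ζ : (D.dual.stab (dualFamily L)).Ker) (z : (D.stab Θ).Ker)
    (ha : ∀ u, a ⬝ᵥ u = ζ.1.1 (Θ u) + ζ.1.2 ⬝ᵥ L (0, u)) :
    a ⬝ᵥ z.1.2 = ζ.1.2 ⬝ᵥ L z.1 := by
  -- Both sides are the value at `z` of the pullback of `ζ` along `(D_Θ, L)`: on the left the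
  -- `X*`-component of the pullback vanishes because `ζ` lies in the kernel, on the right `D_Θ z =
  -- 0`.
  have h1 : D.1 z.1.1 + Θ z.1.2 = 0 := z.2
  have h2 := stab_dual_ker_apply ζ z.1.1
  have h3 : L z.1 = L (z.1.1, 0) + L (0, z.1.2) := by
    rw [← map_add]
    simp
  rw [ha, h3, dotProduct_add, eq_neg_of_add_eq_zero_right h1, map_neg]
  linarith

/-- On the wedge of a dual family, `𝒫` returns the dual vector up to `(-1)^(n choose 2)`; this
accounts for both binomial exponents. The scalars `a` and `b` measure `α` and `β` against the chosen
frames, and placing `b` on the left avoids division. -/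
theorem dualIso_tmul_topOf {D : Fred X Y} {p q : ℕ} (hp : Module.finrank ℝ D.Ker = p)
    (hq : Module.finrank ℝ D.Coker = q) (hq' : Module.finrank ℝ D.dual.Ker = q)
    (hp' : Module.finrank ℝ D.dual.Coker = p)
    (x : Fin p → D.Ker) (c : Fin q → D.Coker) (γ : Fin q → Module.Dual ℝ D.Coker)
    (c' : Fin p → D.dual.Coker) (hγ : ∀ i j, γ i (c j) = if i = j then 1 else 0)
    (hx : ∀ i j, D.dualKer (x i) (c' j) = if i = j then 1 else 0)
    {α : Module.Dual ℝ (Top D.Coker)} {β : Module.Dual ℝ (Top D.dual.Coker)} {a b : ℝ}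
    (hα : α (topOf hq c) = a) (hβ : β (topOf hp' c') = b) :
    b • dualIso D (.tmul D (topOf hp x) α) =
      ((-1 : ℝ) ^ (D.ind * q + q.choose 2 + p.choose 2) * a) •
        .tmul D.dual (topOf hq' (D.dualCoker ∘ γ)) β := by
  have hqd : Module.finrank ℝ (Module.Dual ℝ D.Coker) = q := by
    rw [Subspace.dual_finrank_eq, hq]
  have hpd : Module.finrank ℝ (Module.Dual ℝ D.dual.Coker) = p := by
    rw [Subspace.dual_finrank_eq, hp']
  have h4 : b • dualTop D.dual.Coker (topMap D.dualKer (topOf hp x)) =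
      (-1 : ℝ) ^ p.choose 2 • β := by
    rw [topMap_topOf _ hp hpd, ← hβ]
    exact smul_dualTop_topOf_of_dual hp' hpd hx β
  have h5 : topMap D.dualCoker ((dualTop D.Coker).symm α) =
      ((-1 : ℝ) ^ q.choose 2 * a) • topOf hq' (D.dualCoker ∘ γ) := by
    rw [dualTop_symm_eq_of_dual hq hqd hγ, LinearEquiv.map_smul, topMap_topOf _ hqd hq', hα]
  have h7 : dualIso D (.tmul D (topOf hp x) α) = (-1 : ℝ) ^ (D.ind * q) •
      DetLine.tmul D.dual (topMap D.dualCoker ((dualTop D.Coker).symm α))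
        (dualTop D.dual.Coker (topMap D.dualKer (topOf hp x))) := by
    subst hq
    exact dualIso_tmul D (topOf hp x) α
  have h6 : b • DetLine.tmul D.dual (topMap D.dualCoker ((dualTop D.Coker).symm α))
      (dualTop D.dual.Coker (topMap D.dualKer (topOf hp x))) =
      (((-1 : ℝ) ^ q.choose 2 * a) * (-1 : ℝ) ^ p.choose 2) •
        DetLine.tmul D.dual (topOf hq' (D.dualCoker ∘ γ)) β := by
    rw [← DetLine.tmul_smul, h4, h5, DetLine.tmul_smul, DetLine.smul_tmul, smul_smul, mul_comm]
  have h8 : (-1 : ℝ) ^ (D.ind * q) * (((-1 : ℝ) ^ q.choose 2 * a) * (-1 : ℝ) ^ p.choose 2) =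
      (-1 : ℝ) ^ (D.ind * q + q.choose 2 + p.choose 2) * a := by
    rw [zpow_add₀ (by norm_num), zpow_add₀ (by norm_num), zpow_natCast, zpow_natCast]
    ring
  rw [← h8, h7]
  exact (smul_comm _ _ _).trans ((congrArg _ h6).trans (smul_smul _ _ _))

theorem Fred.finrank_dual_ker (D : Fred X Y) :
    Module.finrank ℝ D.dual.Ker = Module.finrank ℝ D.Coker := by
  rw [← D.dualCoker.finrank_eq, Subspace.dual_finrank_eq]

theorem Fred.finrank_dual_coker (D : Fred X Y) :
    Module.finrank ℝ D.dual.Coker = Module.finrank ℝ D.Ker := by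
  rw [D.dualKer.finrank_eq, Subspace.dual_finrank_eq]

theorem stabSign_eq {D : Fred X Y} {N k r : ℕ} {Θ : (Fin N → ℝ) →L[ℝ] Y}
    (h : Function.Surjective (D.stab Θ).1) (hk : Module.finrank ℝ (D.stab Θ).Ker = k)
    (hr : Module.finrank ℝ (D.toCoker Θ).ker = r) : stabSign D Θ = k * N + N * r := by
  have := Fred.subsingleton_coker h
  rw [stabSign, Fred.ind, hk, hr,
    (Module.finrank_zero_of_subsingleton : Module.finrank ℝ (D.stab Θ).Coker = 0)]
  simp

theorem neg_one_zpow_eq_of_even_sub {a b : ℤ} (h : Even (a - b)) :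
    (-1 : ℝ) ^ a = (-1 : ℝ) ^ b := by
  rw [← sub_add_cancel a b, zpow_add₀ (by norm_num), h.neg_one_zpow, one_mul]

/-- The total exponents on the two sides of the frame comparison, with `N = r + q` and `k = r + p`.
The terms `pr` and `qr` come from reordering the frames, the terms in `kN`, `Nr` and `kr` from the
two stabilizations, those in `(p - q)q` and the binomials from dualization, and the quotient by 2 is
the claimed sign. -/
theorem dual_sign_parity (p q r : ℕ) :
    Even ((p * r + ((r + p : ℕ) * (r + q : ℕ) + (r + q : ℕ) * r) +
      (((p : ℤ) - q) * q + q.choose 2 + p.choose 2)) -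
      (((p : ℤ) - q) * (p - q - 1) / 2 + q * r + ((r + q : ℕ) * (r + p : ℕ) + (r + p : ℕ) * r))) := by
  have h : ∀ n : ℕ, (n : ℤ) * (n - 1) = 2 * n.choose 2 := fun n => by
    rw [Nat.choose_two_right]
    obtain ⟨m, hm⟩ := Nat.even_mul_pred_self n
    rcases n with - | n
    · simp
    · rw [hm, ← two_mul, Nat.mul_div_cancel_left _ two_pos]
      have := congrArg (Nat.cast : ℕ → ℤ) hm
      push_cast [Nat.add_sub_cancel] at this ⊢
      linarith
  have hp := h p
  have hq := h q
  generalize (p.choose 2 : ℤ) = a at *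
  generalize (q.choose 2 : ℤ) = b at *
  -- This is the expansion of the binomial coefficient of `p - q` over 2, valid also when `p - q` is
  -- negative.
  have h1 : ((p : ℤ) - q) * (p - q - 1) / 2 = a + b + q - p * q := by
    rw [show ((p : ℤ) - q) * (p - q - 1) = 2 * (a + b + q - p * q) by linarith,
      Int.mul_ediv_cancel_left _ two_ne_zero]
  rw [h1]
  -- After cancellation the difference is `2pq - q² - q`, and `q² = 2b + q`.
  refine ⟨p * q - b - q, ?_⟩
  push_cast
  have : (q : ℤ) * q = 2 * b + q := by linarith
  linear_combination -this

end Fredholm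

/-! ### Dualization compares the frames of the two stabilized kernels. -/

theorem det_ne_zero_of_topOf_ne_zero {V : Type*} [AddCommGroup V] [Module ℝ V] {n : ℕ}
    (h : Module.finrank ℝ V = n) (e : V ≃ₗ[ℝ] (Fin n → ℝ)) {v : Fin n → V} (hv : topOf h v ≠ 0) :
    (Matrix.of fun i => e (v i)).det ≠ 0 := by
  intro h0
  rw [topOf_eq_det_smul h (Module.Basis.ofEquivFun e), detBasis_equiv, h0, zero_smul] at hv
  exact hv rfl

theorem tmul_ne_zero_of_ne_zero {V W : Type*} [AddCommGroup V] [Module ℝ V] [AddCommGroup W]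
    [Module ℝ W] {x : V} {y : W} (hx : x ≠ 0) (hy : y ≠ 0) : x ⊗ₜ[ℝ] y ≠ 0 := by
  obtain ⟨f, hf⟩ := Module.Projective.exists_dual_eq_one ℝ hx
  obtain ⟨g, hg⟩ := Module.Projective.exists_dual_eq_one ℝ hy
  intro h
  have h1 := congrArg (TensorProduct.map f g) h
  have h2 := congrArg (TensorProduct.lid ℝ ℝ) h1
  simp [hf, hg] at h2

theorem ShortExact.topOf_append_ne_zero {V V' V'' : Type*} [AddCommGroup V] [Module ℝ V]
    [AddCommGroup V'] [Module ℝ V'] [AddCommGroup V''] [Module ℝ V'']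
    [FiniteDimensional ℝ V] {i : V' →ₗ[ℝ] V} {j : V →ₗ[ℝ] V''}
    (h : ShortExact i j) {p r : ℕ} (hp : Module.finrank ℝ V' = p) (hr : Module.finrank ℝ V'' = r)
    (hk : Module.finrank ℝ V = p + r) (b : Module.Basis (Fin p) ℝ V')
    (b' : Module.Basis (Fin r) ℝ V'') (v : Fin r → V) (hv : j ∘ v = b') :
    topOf hk (Fin.append (i ∘ b) v) ≠ 0 := by
  rw [← h.wedge_topOf hp hr hk, hv, LinearEquiv.map_ne_zero_iff]
  exact tmul_ne_zero_of_ne_zero (topOf_basis_ne_zero hp b) (topOf_basis_ne_zero hr b')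

/-- Cancellation of the determinants in the comparison of two frames. -/
theorem map_eq_smul_of_dets {M M' : Type*} [AddCommGroup M] [Module ℝ M] [AddCommGroup M']
    [Module ℝ M'] (f : M →ₗ[ℝ] M') {A T : M} {A' T' : M'} {dE dP dR dR' s s₁ s₂ s₃ : ℝ}
    (h₁ : dE • A = s₁ • T) (h₂ : dR • A' = s₂ • T') (h₃ : dR' • f T = (s₃ * dP) • T')
    (hP : dR * dP = 1) (hE : dR' * dE = 1) (hs : s₁ * s₃ = s * s₂) : f A = s • A' := by
  calc f A = dR' • f (dE • A) := by rw [map_smul, smul_smul, hE, one_smul]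
    _ = s₁ • dR' • f T := by rw [h₁, map_smul, smul_comm]
    _ = (s * dP) • s₂ • T' := by
      rw [h₃, smul_smul, smul_smul, ← mul_assoc, hs]
      congr 1
      ring
    _ = (s * (dR * dP)) • A' := by
      rw [← h₂, smul_smul]
      congr 1
      ring
    _ = s • A' := by rw [hP, mul_one]

section Fredholm

open scoped Matrix

variable {X Y : Type*} [NormedAddCommGroup X] [NormedSpace ℝ X] [NormedAddCommGroup Y]
  [NormedSpace ℝ Y]

/-- `stabTop` on the frame of `κ(D_Θ)` given by a linear isomorphism with `ℝᵏ`. -/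
theorem det_smul_stabTop {D : Fred X Y} {N p r : ℕ} {Θ : (Fin N → ℝ) →L[ℝ] Y}
    (h : Function.Surjective (D.stab Θ).1) (hp : Module.finrank ℝ D.Ker = p)
    (hr : Module.finrank ℝ (D.toCoker Θ).ker = r)
    (hk : Module.finrank ℝ (D.stab Θ).Ker = r + p)
    (e : (D.stab Θ).Ker ≃ₗ[ℝ] (Fin (r + p) → ℝ)) (x : Fin p → D.Ker)
    (v : Fin r → (D.stab Θ).Ker) :
    (Matrix.of fun i => e (Fin.append v (D.kerIncl Θ ∘ x) i)).det •
        stabTop h (topOf hk (Module.Basis.ofEquivFun e)) =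
      (-1 : ℝ) ^ ((p * r : ℤ) + stabSign D Θ) •
        DetLine.tmul D (topOf hp x) (contract h (topOf hr (D.kerProj Θ ∘ v))) := by
  have hk' : Module.finrank ℝ (D.stab Θ).Ker = p + r := by rw [hk, add_comm]
  have h1 := stabTop_topOf h hp hr hk' x v
  rw [← detBasis_equiv, ← LinearMap.map_smul, ← topOf_eq_det_smul, zpow_add₀ (by norm_num),
    mul_smul, ← h1, ← LinearMap.map_smul]
  congr 1
  have h2 : (-1 : ℝ) ^ ((p : ℤ) * r) = (-1) ^ (r * p) := by
    rw [mul_comm r p, ← zpow_natCast, Nat.cast_mul]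
  -- Here the lifts `v` precede the vectors of `κ(D)`, whereas the exact sequence puts `κ(D)` first;
  -- the exchange costs `(-1)^(pr)`.
  rw [topOf_append_comm hk hk', h2]

variable {D : Fred X Y} {p q r : ℕ} {Θ : (Fin (r + q) → ℝ) →L[ℝ] Y}
  {L : X × (Fin (r + q) → ℝ) →L[ℝ] (Fin (r + p) → ℝ)}

/-- Bases adapted to `κ(D)`, `Q` and `c(D)` express both frame vectors through decomposable tensors,
at the cost of four determinants. The vectors on the dual side are chosen from the inverse
transposes of the matrices `P` and `E`, which makes the determinants cancel in pairs and leaves only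
signs. -/
theorem dualIso_stabTop_aux (h : Function.Surjective (D.stab Θ).1)
    (h' : Function.Surjective (D.dual.stab (dualFamily L)).1)
    (hp : Module.finrank ℝ D.Ker = p) (hq : Module.finrank ℝ D.Coker = q)
    (hr : Module.finrank ℝ (D.toCoker Θ).ker = r)
    (hk : Module.finrank ℝ (D.stab Θ).Ker = r + p)
    (hN : Module.finrank ℝ (D.dual.stab (dualFamily L)).Ker = r + q)
    (e : (D.stab Θ).Ker ≃ₗ[ℝ] (Fin (r + p) → ℝ)) (he : ∀ z, e z = L z.1)
    (e' : (D.dual.stab (dualFamily L)).Ker ≃ₗ[ℝ] (Fin (r + q) → ℝ))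
    (he' : ∀ ζ u, e' ζ ⬝ᵥ u = ζ.1.1 (Θ u) + ζ.1.2 ⬝ᵥ L (0, u)) :
    dualIso D (stabTop h (topOf hk (Module.Basis.ofEquivFun e))) =
      (-1 : ℝ) ^ (((p : ℤ) - q) * (p - q - 1) / 2) •
        stabTop h' (topOf hN (Module.Basis.ofEquivFun e')) := by
  have hq' : Module.finrank ℝ D.dual.Ker = q := by rw [D.finrank_dual_ker, hq]
  have hp' : Module.finrank ℝ D.dual.Coker = p := by rw [D.finrank_dual_coker, hp]
  have hr' : Module.finrank ℝ (D.dual.toCoker (dualFamily L)).ker = r := by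
    have := (Fred.shortExact_coker h').finrank_eq
    rw [hp', Module.finrank_fin_fun] at this
    omega
  let x := Module.finBasisOfFinrankEq ℝ D.Ker hp
  let bQ := Module.finBasisOfFinrankEq ℝ (D.toCoker Θ).ker hr
  let bC := Module.finBasisOfFinrankEq ℝ D.Coker hq
  -- The `v i` lift a basis of `Q` to `κ(D_Θ)`, and the `w i` below lift a basis of `c(D)` to `ℝᴺ`.
  choose v hv using fun i => (D.shortExact_ker Θ).surj (bQ i)
  choose w hw using fun i => (Fred.shortExact_coker h).surj (bC i)
  have hv' : D.kerProj Θ ∘ v = bQ := funext hv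
  have hw' : D.toCoker Θ ∘ w = bC := funext hw
  have hv2 : ∀ i, D.toCoker Θ (v i).1.2 = 0 := fun i => (D.kerProj Θ (v i)).2
  -- `P` compares the adapted basis of `ℝᴺ` with the standard one; `E` below compares the adapted
  -- basis of `κ(D_Θ)` with the frame of `e`.
  let P : Matrix (Fin (r + q)) (Fin (r + q)) ℝ := Matrix.of (Fin.append (fun i => (v i).1.2) w)
  have hPl : ∀ j, P (Fin.castAdd q j) = (v j).1.2 := fun j =>
    Fin.append_left (fun i => (v i).1.2) w j
  have hPr : ∀ j, P (Fin.natAdd r j) = w j := fun j =>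
    Fin.append_right (fun i => (v i).1.2) w j
  let E : Matrix (Fin (r + p)) (Fin (r + p)) ℝ :=
    Matrix.of fun i => e (Fin.append v (D.kerIncl Θ ∘ x) i)
  have hEl : ∀ j, E (Fin.castAdd p j) = e (v j) := fun j =>
    congrArg e (Fin.append_left _ _ j)
  have hEr : ∀ j, E (Fin.natAdd r j) = e (D.kerIncl Θ (x j)) := fun j =>
    congrArg e (Fin.append_right _ _ j)
  have hP : IsUnit Pᵀ.det := by
    rw [Matrix.det_transpose, isUnit_iff_ne_zero]
    refine det_ne_zero_of_topOf_ne_zero (Module.finrank_fin_fun ℝ) (LinearEquiv.refl ℝ _)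
      (v := Fin.append (fun i => (v i).1.2) w) ?_
    have h1 := (Fred.shortExact_coker h).topOf_append_ne_zero hr hq
      (Module.finrank_fin_fun ℝ) bQ bC w hw'
    rw [← hv'] at h1
    exact h1
  have hE : IsUnit Eᵀ.det := by
    rw [Matrix.det_transpose, isUnit_iff_ne_zero]
    refine det_ne_zero_of_topOf_ne_zero hk e ?_
    have hk' : Module.finrank ℝ (D.stab Θ).Ker = p + r := by rw [hk, add_comm]
    have h1 := (D.shortExact_ker Θ).topOf_append_ne_zero hp hr hk' x bQ v hv'
    rw [topOf_append_comm hk' hk] at h1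
    exact fun h0 => h1 (by rw [h0, smul_zero])
  have hPi := Matrix.nonsing_inv_mul _ hP
  have hEi := Matrix.nonsing_inv_mul _ hE
  -- The adapted data for `D*`: `y` is the basis of `κ(D*)` dual to `bC`. The first `r` rows of the
  -- inverse of `Pᵀ` give, through `e'`, the kernel vectors `σ`, and the last `p` rows of the
  -- inverse of `Eᵀ` give the lifts `u` of a basis of `c(D*)`.
  let y : Fin q → D.dual.Ker := D.dualCoker ∘ bC.coord
  let s : Fin r → Fin (r + q) → ℝ := fun i => Pᵀ⁻¹ (Fin.castAdd q i)
  let σ : Fin r → (D.dual.stab (dualFamily L)).Ker := fun i => e'.symm (s i)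
  let u : Fin p → Fin (r + p) → ℝ := fun i => Eᵀ⁻¹ (Fin.natAdd r i)
  have hs : ∀ i j, s i ⬝ᵥ P j = (1 : Matrix _ _ ℝ) (Fin.castAdd q i) j := fun i j =>
    congrFun (congrFun hPi _) _
  have hu : ∀ i j, u i ⬝ᵥ E j = (1 : Matrix _ _ ℝ) (Fin.natAdd r i) j := fun i j =>
    congrFun (congrFun hEi _) _
  let R : Matrix (Fin (r + q)) (Fin (r + q)) ℝ :=
    Matrix.of fun i => e' (Fin.append σ (D.dual.kerIncl (dualFamily L) ∘ y) i)
  have hRl : ∀ j, R (Fin.castAdd q j) = s j := fun j =>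
    (congrArg e' (Fin.append_left _ _ j)).trans (e'.apply_symm_apply _)
  have hRr : ∀ j, R (Fin.natAdd r j) = e' (D.dual.kerIncl (dualFamily L) (y j)) := fun j =>
    congrArg e' (Fin.append_right _ _ j)
  let R' : Matrix (Fin (r + p)) (Fin (r + p)) ℝ := Matrix.of (Fin.append (fun i => (σ i).1.2) u)
  have hR'l : ∀ j, R' (Fin.castAdd p j) = (σ j).1.2 := fun j =>
    Fin.append_left (fun i => (σ i).1.2) u j
  have hR'r : ∀ j, R' (Fin.natAdd r j) = u j := fun j =>
    Fin.append_right (fun i => (σ i).1.2) u j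
  have hy : ∀ i a, e' (D.dual.kerIncl (dualFamily L) (y i)) ⬝ᵥ a =
      bC.coord i (D.toCoker Θ a) := fun i a => by
    rw [he']
    change bC.coord i (D.toCoker Θ a) + (0 : Fin (r + p) → ℝ) ⬝ᵥ _ = _
    rw [zero_dotProduct, add_zero]
  -- The first `r` rows are right by the choice of `s`. The others pair with a vector through its
  -- class in `c(D)`, so they vanish on `Q` and are dual to `w`.
  have hRP : R * Pᵀ = 1 := by
    ext i j
    change R i ⬝ᵥ P j = _
    refine Fin.addCases (fun i => ?_) (fun i => ?_) i
    · rw [hRl, hs]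
    · rw [hRr, hy]
      refine Fin.addCases (fun j => ?_) (fun j => ?_) j
      · rw [hPl, hv2, map_zero, Matrix.one_apply_ne]
        simp [Fin.ext_iff]; omega
      · rw [hPr, hw, Matrix.one_apply]
        simp [Module.Basis.coord_apply, Finsupp.single_apply, eq_comm]
  -- The last `p` rows are right by the choice of `u`. For the first `r`, `dotProduct_stab_ker`
  -- turns the pairing with `e z` into the pairing of `s i` with the `ℝᴺ`-component of `z`, which is
  -- zero for `z` from `κ(D)`.
  have hRE : R' * Eᵀ = 1 := by
    ext i j
    change R' i ⬝ᵥ E j = _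
    refine Fin.addCases (fun i => ?_) (fun i => ?_) i
    · have hz : ∀ z : (D.stab Θ).Ker, (σ i).1.2 ⬝ᵥ e z = s i ⬝ᵥ z.1.2 := fun z => by
        rw [he, ← dotProduct_stab_ker (σ i) z (he' (σ i)), e'.apply_symm_apply]
      rw [hR'l]
      refine Fin.addCases (fun j => ?_) (fun j => ?_) j
      · rw [hEl, hz, ← hPl, hs]
        simp [Matrix.one_apply]
      · rw [hEr, hz]
        change s i ⬝ᵥ (0 : Fin (r + q) → ℝ) = _
        rw [dotProduct_zero, Matrix.one_apply_ne]
        simp [Fin.ext_iff]; omega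
    · rw [hR'r, hu]
  -- The last `p` rows of `E` are the vectors `L (x i, 0)`, so the classes of the `u j` in `c(D*)`
  -- are dual to the `x i`.
  have hx : ∀ i j, D.dualKer (x i) (D.dual.toCoker (dualFamily L) (u j)) =
      if i = j then 1 else 0 := fun i j => by
    have h1 := hu j (Fin.natAdd r i)
    rw [hEr, he, Matrix.one_apply] at h1
    change dualFamily L (u j) (x i : X) = _
    rw [dualFamily_apply]
    refine h1.trans ?_
    simp [eq_comm]
  have hW : contract h (topOf hr (D.kerProj Θ ∘ v)) (topOf hq (D.toCoker Θ ∘ w)) = P.det :=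
    contract_topOf h hr hq _ w
  have hU : contract h' (topOf hr' (D.dual.kerProj (dualFamily L) ∘ σ))
      (topOf hp' (D.dual.toCoker (dualFamily L) ∘ u)) = R'.det :=
    contract_topOf h' hr' hp' _ u
  refine map_eq_smul_of_dets (dualIso D).toLinearMap (det_smul_stabTop h hp hr hk e x v)
    (det_smul_stabTop h' hq' hr' hN e' y σ)
    (dualIso_tmul_topOf hp hq hq' hp' x _ bC.coord _ (fun i j => ?_) hx hW hU) ?_ ?_ ?_
  · change bC.coord i (D.toCoker Θ (w j)) = _
    rw [hw]
    simp [Module.Basis.coord_apply, Finsupp.single_apply, eq_comm]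
  · have := congrArg Matrix.det hRP
    rwa [Matrix.det_mul, Matrix.det_transpose, Matrix.det_one] at this
  · have := congrArg Matrix.det hRE
    rwa [Matrix.det_mul, Matrix.det_transpose, Matrix.det_one] at this
  · rw [← zpow_add₀ (by norm_num), ← zpow_add₀ (by norm_num), stabSign_eq h hk hr,
      stabSign_eq h' hN hr', Fred.ind, hp, hq]
    refine neg_one_zpow_eq_of_even_sub ?_
    convert dual_sign_parity p q r using 1
    ring

end Fredholm

section Fredholm

variable {X Y : Type*} [NormedAddCommGroup X] [NormedSpace ℝ X] [NormedAddCommGroup Y]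
  [NormedSpace ℝ Y]

/-! ### Chart domains and continuity of kernel frames -/

theorem continuous_stab {N : ℕ} (Θ : (Fin N → ℝ) →L[ℝ] Y) :
    Continuous fun D : Fred X Y => (D.stab Θ).1 := by
  have h : (fun D : Fred X Y => (D.stab Θ).1) = fun D : Fred X Y =>
      D.1 ∘L ContinuousLinearMap.fst ℝ X (Fin N → ℝ) +
        Θ ∘L ContinuousLinearMap.snd ℝ X (Fin N → ℝ) := by
    funext D
    apply ContinuousLinearMap.ext
    intro z
    rfl
  rw [h]
  exact (continuous_subtype_val.clm_comp continuous_const).add continuous_const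

theorem continuous_dual : Continuous (Fred.dual : Fred X Y → _) := by
  refine Continuous.subtype_mk ?_ _
  exact ((ContinuousLinearMap.compL ℝ X Y ℝ).flip).continuous.comp continuous_subtype_val

namespace Chart

variable (c : Chart X Y)

/-- The endomorphism `T D_Θ + (1 - T E₀)` of `X ⊕ ℝᴺ`, which extends `Φ` and is invertible exactly
when `D` lies in the domain of the chart. -/
noncomputable def shear (D : Fred X Y) : (X × (Fin c.N → ℝ)) →L[ℝ] (X × (Fin c.N → ℝ)) :=
  c.T ∘L (D.stab c.Θ).1 + (ContinuousLinearMap.id ℝ _ - c.T ∘L c.E₀.1)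

theorem shear_apply (D : Fred X Y) (z : X × (Fin c.N → ℝ)) :
    c.shear D z = c.T ((D.stab c.Θ).1 z) + (z - c.T (c.E₀.1 z)) :=
  rfl

theorem E₀_shear (D : Fred X Y) (z : X × (Fin c.N → ℝ)) :
    c.E₀.1 (c.shear D z) = (D.stab c.Θ).1 z := by
  rw [shear_apply, map_add, map_sub, c.rightInv, c.rightInv, sub_self, add_zero]

theorem coe_proj (D : Fred X Y) (z : (D.stab c.Θ).Ker) :
    (c.proj (D.stab c.Θ) z : X × (Fin c.N → ℝ)) = c.shear D z := by
  have h : (D.stab c.Θ).1 z = 0 := z.2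
  rw [shear_apply, h, map_zero, zero_add]
  rfl

theorem continuous_shear : Continuous c.shear :=
  (continuous_const.clm_comp (continuous_stab c.Θ)).add continuous_const

/-- Since `E₀ ∘ shear = D_Θ`, the shear restricts to `Φ` on `κ(D_Θ)` and covers the identity of `Y`;
a diagram chase then compares the two kernel sequences. Completeness of `X` makes a bijective
operator a unit. -/
theorem mem_dom_iff [CompleteSpace X] {D : Fred X Y} : D ∈ c.dom ↔ IsUnit (c.shear D) := by
  rw [ContinuousLinearMap.isUnit_iff_bijective]
  constructor
  · rintro ⟨hs, hΦ⟩
    constructor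
    · rw [injective_iff_map_eq_zero]
      intro z hz
      have h1 : (D.stab c.Θ).1 z = 0 := by rw [← c.E₀_shear, hz, map_zero]
      have h2 : c.proj (D.stab c.Θ) ⟨z, h1⟩ = 0 := Subtype.ext ((c.coe_proj D _).trans hz)
      exact congrArg Subtype.val ((map_eq_zero_iff _ hΦ.1).1 h2)
    · intro w
      obtain ⟨z, hz⟩ := hs (c.E₀.1 w)
      have h1 : c.E₀.1 (w - c.shear D z) = 0 := by rw [map_sub, c.E₀_shear, hz, sub_self]
      obtain ⟨z', hz'⟩ := hΦ.2 ⟨_, h1⟩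
      refine ⟨z + z', ?_⟩
      rw [map_add, ← c.coe_proj, hz', add_sub_cancel]
  · rintro ⟨hi, hs⟩
    refine ⟨fun y => ?_, ?_, fun w => ?_⟩
    · obtain ⟨z, hz⟩ := hs (c.T y)
      exact ⟨z, by rw [← c.E₀_shear, hz, c.rightInv]⟩
    · intro z z' h
      apply Subtype.ext
      apply hi
      rw [← c.coe_proj, ← c.coe_proj, h]
    · obtain ⟨z, hz⟩ := hs w
      have h0 : c.E₀.1 w = 0 := w.2
      have h1 : (D.stab c.Θ).1 z = 0 := by rw [← c.E₀_shear, hz, h0]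
      exact ⟨⟨z, h1⟩, Subtype.ext ((c.coe_proj D _).trans hz)⟩

theorem isOpen_dom [CompleteSpace X] : IsOpen c.dom := by
  have h : c.dom = c.shear ⁻¹' {f | IsUnit f} := Set.ext fun D => c.mem_dom_iff
  rw [h]
  exact Units.isOpen.preimage c.continuous_shear

/-- The isomorphism `Φ : κ(D_Θ) → κ(E₀)`. -/
noncomputable def kerEquiv (D : c.dom) : (D.1.stab c.Θ).Ker ≃ₗ[ℝ] c.E₀.Ker :=
  LinearEquiv.ofBijective _ D.2.2

/-- On `κ(E₀)` the inverse of `Φ` agrees with the inverse of the shear, and inversion is continuous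
at units of a complete normed ring. -/
theorem continuous_kerEquiv_symm [CompleteSpace X] (w : c.E₀.Ker) :
    Continuous fun D : c.dom => ((c.kerEquiv D).symm w : X × (Fin c.N → ℝ)) := by
  have h : (fun D : c.dom => ((c.kerEquiv D).symm w : X × (Fin c.N → ℝ))) =
      fun D : c.dom => Ring.inverse (c.shear D.1) (w : X × (Fin c.N → ℝ)) := by
    funext D
    have h1 : c.shear D.1 ((c.kerEquiv D).symm w : X × (Fin c.N → ℝ)) = w := by
      rw [← c.coe_proj]
      exact congrArg Subtype.val ((c.kerEquiv D).apply_symm_apply w)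
    conv_rhs => rw [← h1]
    exact (congrArg (fun f : (X × (Fin c.N → ℝ)) →L[ℝ] (X × (Fin c.N → ℝ)) =>
      f ((c.kerEquiv D).symm w : X × (Fin c.N → ℝ)))
      (Ring.inverse_mul_cancel _ (c.mem_dom_iff.1 D.2))).symm
  rw [h]
  refine Continuous.clm_apply ?_ continuous_const
  rw [continuous_iff_continuousAt]
  intro D
  obtain ⟨u, hu⟩ := c.mem_dom_iff.1 D.2
  have h2 := NormedRing.inverse_continuousAt u
  rw [hu] at h2
  exact ContinuousAt.comp (g := Ring.inverse) (f := fun D : c.dom => c.shear D.1) h2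
    (c.continuous_shear.comp continuous_subtype_val).continuousAt

/-- Both cokernels are zero, and the identification of their determinant lines sends the empty wedge
to itself; only the factor `λ(Φ)⁻¹` remains. -/
theorem detSurj_kerMap (D : c.dom) (σ : DetLine (X × (Fin c.N → ℝ)) Y c.E₀) :
    detSurj D.2.1 (c.kerMap D σ) = (topMap (c.kerEquiv D)).symm (detSurj c.surjective σ) := by
  have := Fred.subsingleton_coker c.surjective
  have := Fred.subsingleton_coker D.2.1
  have h0 : Module.finrank ℝ c.E₀.Coker = 0 := Module.finrank_zero_of_subsingleton
  have h0' : Module.finrank ℝ (D.1.stab c.Θ).Coker = 0 := Module.finrank_zero_of_subsingleton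
  refine TensorProduct.induction_on (motive := fun σ => detSurj D.2.1 (c.kerMap D σ) =
    (topMap (c.kerEquiv D)).symm (detSurj c.surjective σ)) σ ?_ (fun x α => ?_)
    (fun x y hx hy => ?_)
  · exact ((congrArg _ (map_zero _)).trans (map_zero _)).trans
      ((congrArg _ (map_zero _)).trans (LinearEquiv.map_zero _)).symm
  · have h1 : evalOne h0' ((topMap (LinearEquiv.ofSubsingleton (D.1.stab c.Θ).Coker
        c.E₀.Coker)).dualMap α) = evalOne h0 α :=
      congrArg α ((topMap_topOf _ h0' h0 ![]).trans (congrArg (topOf h0) (Subsingleton.elim _ _)))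
    refine (detSurj_tmul D.2.1 ((topMap (c.kerEquiv D)).symm x) _).trans ?_
    refine Eq.trans ?_ (congrArg _ (detSurj_tmul c.surjective x α)).symm
    rw [LinearEquiv.map_smul]
    exact congrArg (· • _) h1
  · exact ((congrArg _ (map_add _ _ _)).trans (map_add _ _ _)).trans
      ((congrArg₂ _ hx hy).trans
        ((congrArg _ (map_add _ _ _)).trans (LinearEquiv.map_add _ _ _)).symm)

/-- A chart in terms of the frame of `κ(D_Θ)` given by linear coordinates. -/
theorem map_snd_eq {k : ℕ} (D : c.dom) (hk₀ : Module.finrank ℝ c.E₀.Ker = k)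
    (hk : Module.finrank ℝ (D.1.stab c.Θ).Ker = k) (f : Fin k → c.E₀.Ker)
    (e : (D.1.stab c.Θ).Ker ≃ₗ[ℝ] (Fin k → ℝ)) {a : ℝ}
    {σ : DetLine (X × (Fin c.N → ℝ)) Y c.E₀} (hσ : detSurj c.surjective σ = a • topOf hk₀ f) :
    (c.map (D, σ)).2 = (a * (Matrix.of fun i => e ((c.kerEquiv D).symm (f i))).det) •
      stabTop D.2.1 (topOf hk (Module.Basis.ofEquivFun e)) := by
  have h1 : (topMap (c.kerEquiv D)).symm (topOf hk₀ f) = topOf hk ((c.kerEquiv D).symm ∘ f) := by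
    rw [LinearEquiv.symm_apply_eq, topMap_topOf _ hk hk₀]
    congr 1
    funext i
    simp
  have h2 : detSurj D.2.1 (c.kerMap D σ) =
      (a * (Matrix.of fun i => e ((c.kerEquiv D).symm (f i))).det) •
        topOf hk (Module.Basis.ofEquivFun e) := by
    rw [detSurj_kerMap, hσ, LinearEquiv.map_smul, h1,
      topOf_eq_det_smul hk (Module.Basis.ofEquivFun e), detBasis_equiv, smul_smul]
    rfl
  exact (stabMap_eq D.2.1 (c.kerMap D σ)).trans ((congrArg _ h2).trans (LinearMap.map_smul _ _ _))

theorem continuous_map : Continuous c.map :=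
  continuous_iff_coinduced_le.2 (le_iSup (fun c : Chart X Y =>
    TopologicalSpace.coinduced c.map inferInstance) c)

end Chart

theorem continuous_of_comp_map {Z : Type*} [TopologicalSpace Z]
    {f : Bundle.TotalSpace ℝ (DetLine X Y) → Z}
    (h : ∀ c : Chart X Y, Continuous (f ∘ c.map)) : Continuous f :=
  continuous_iSup_dom.2 fun c => continuous_coinduced_dom.2 (h c)

/-! ### Extension of `D_Θ` to an isomorphism -/

variable {N k : ℕ}

/-- Inverse of the transpose of an isomorphism `A : X ⊕ ℝᴺ → Y ⊕ ℝᵏ`, where functionals on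
`Y ⊕ ℝᵏ` are regarded as elements of `Y* ⊕ ℝᵏ`. -/
noncomputable def transposeInv (A : (X × (Fin N → ℝ)) ≃L[ℝ] (Y × (Fin k → ℝ))) :
    StrongDual ℝ (X × (Fin N → ℝ)) →L[ℝ] StrongDual ℝ Y × (Fin k → ℝ) :=
  (ContinuousLinearMap.precomp ℝ (A.symm.toContinuousLinearMap ∘L
      ContinuousLinearMap.inl ℝ Y (Fin k → ℝ))).prod
    (ContinuousLinearMap.pi fun m => ContinuousLinearMap.apply ℝ ℝ (A.symm (0, Pi.single m 1)))

theorem transposeInv_apply (A : (X × (Fin N → ℝ)) ≃L[ℝ] (Y × (Fin k → ℝ)))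
    (ψ : StrongDual ℝ (X × (Fin N → ℝ))) (z : X × (Fin N → ℝ)) :
    (transposeInv A ψ).1 (A z).1 + (transposeInv A ψ).2 ⬝ᵥ (A z).2 = ψ z := by
  have h1 : (transposeInv A ψ).2 ⬝ᵥ (A z).2 = ψ (A.symm (0, (A z).2)) := by
    let l : (Fin k → ℝ) →ₗ[ℝ] ℝ := ψ.toLinearMap ∘ₗ A.symm.toLinearEquiv.toLinearMap ∘ₗ
      LinearMap.inr ℝ Y (Fin k → ℝ)
    have h2 := LinearMap.pi_apply_eq_sum_univ l (A z).2
    refine Eq.trans ?_ h2.symm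
    refine Finset.sum_congr rfl fun m _ => ?_
    rw [smul_eq_mul, mul_comm]
    congr 1
    change ψ (A.symm (0, Pi.single m 1)) = ψ (A.symm (0, _))
    congr 3
    funext j
    simp [Pi.single_apply, eq_comm]
  have h3 : (transposeInv A ψ).1 (A z).1 = ψ (A.symm ((A z).1, 0)) := rfl
  rw [h1, h3, ← map_add, ← map_add]
  simp

/-- The coordinates `(β, d) ↦ (β (Θ eₙ) + ⟨d, L (0, eₙ)⟩)ₙ` on `Y* ⊕ ℝᵏ`. -/
noncomputable def dualCoords (Θ : (Fin N → ℝ) →L[ℝ] Y)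
    (L : X × (Fin N → ℝ) →L[ℝ] (Fin k → ℝ)) :
    StrongDual ℝ Y × (Fin k → ℝ) →L[ℝ] (Fin N → ℝ) :=
  ContinuousLinearMap.pi fun n =>
    (ContinuousLinearMap.apply ℝ ℝ (Θ (Pi.single n 1))).coprod
      (∑ m, L (0, Pi.single n 1) m • ContinuousLinearMap.proj m)

theorem dualCoords_dotProduct (Θ : (Fin N → ℝ) →L[ℝ] Y)
    (L : X × (Fin N → ℝ) →L[ℝ] (Fin k → ℝ)) (ζ : StrongDual ℝ Y × (Fin k → ℝ))
    (u : Fin N → ℝ) : dualCoords Θ L ζ ⬝ᵥ u = ζ.1 (Θ u) + ζ.2 ⬝ᵥ L (0, u) := by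
  let l : (Fin N → ℝ) →ₗ[ℝ] ℝ := ζ.1.toLinearMap ∘ₗ Θ.toLinearMap +
    (dotProductBilin ℝ ℝ ζ.2) ∘ₗ L.toLinearMap ∘ₗ LinearMap.inr ℝ X (Fin N → ℝ)
  have h2 := LinearMap.pi_apply_eq_sum_univ l u
  refine Eq.trans ?_ h2.symm
  refine Finset.sum_congr rfl fun n _ => ?_
  have h3 : (fun j => if n = j then (1 : ℝ) else 0) = Pi.single n 1 := by
    funext j
    simp [Pi.single_apply, eq_comm]
  rw [smul_eq_mul, mul_comm, h3]
  congr 1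
  simp [dualCoords, l, dotProduct, mul_comm]

variable {D : Fred X Y} {Θ : (Fin N → ℝ) →L[ℝ] Y} {L : X × (Fin N → ℝ) →L[ℝ] (Fin k → ℝ)}
  {A : (X × (Fin N → ℝ)) ≃L[ℝ] (Y × (Fin k → ℝ))}

/-- The stabilized transpose is the `X*`-component of the transpose of `A`, so `transposeInv A`
supplies a right inverse for it. -/
theorem stab_dual_transposeInv (hA : ∀ z, A z = ((D.stab Θ).1 z, L z))
    (ψ : StrongDual ℝ (X × (Fin N → ℝ))) (x : X) :
    (D.dual.stab (dualFamily L)).1 (transposeInv A ψ) x = ψ (x, 0) := by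
  rw [← transposeInv_apply A ψ, hA]
  change (transposeInv A ψ).1 (D.1 x) + dualFamily L (transposeInv A ψ).2 x =
    (transposeInv A ψ).1 (D.1 x + Θ 0) + _
  rw [dualFamily_apply, map_zero, add_zero]

/-- The coordinates on `κ(D_Θ)` given by `L`. -/
noncomputable def kerCoords (hA : ∀ z, A z = ((D.stab Θ).1 z, L z)) :
    (D.stab Θ).Ker ≃ₗ[ℝ] (Fin k → ℝ) :=
  LinearEquiv.ofBijective (L.toLinearMap ∘ₗ (D.stab Θ).1.ker.subtype) (by
    constructor
    · intro z z' h
      apply Subtype.ext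
      apply A.injective
      have h1 : (D.stab Θ).1 z = 0 := z.2
      have h2 : (D.stab Θ).1 z' = 0 := z'.2
      rw [hA, hA, h1, h2]
      exact congrArg _ h
    · intro d
      have h := (hA _).symm.trans (A.apply_symm_apply (0, d))
      exact ⟨⟨A.symm (0, d), congrArg Prod.fst h⟩, congrArg Prod.snd h⟩)

/-- The coordinates on the kernel of the stabilized transpose given by `dualCoords`. -/
noncomputable def dualKerCoords (hA : ∀ z, A z = ((D.stab Θ).1 z, L z)) :
    (D.dual.stab (dualFamily L)).Ker ≃ₗ[ℝ] (Fin N → ℝ) :=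
  LinearEquiv.ofBijective
    ((dualCoords Θ L).toLinearMap ∘ₗ (D.dual.stab (dualFamily L)).1.ker.subtype) (by
    constructor
    · rw [injective_iff_map_eq_zero]
      intro ζ hζ
      -- Membership in the kernel and vanishing coordinates together say that the transpose of `A`
      -- kills `ζ`; since `A` is onto, `ζ = 0`.
      have h1 : ∀ z, ζ.1.1 (A z).1 + ζ.1.2 ⬝ᵥ (A z).2 = 0 := fun z => by
        have h2 := dualCoords_dotProduct Θ L ζ.1 z.2
        have h3 : dualCoords Θ L ζ.1 = 0 := hζ
        have h4 := stab_dual_ker_apply ζ z.1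
        have h5 : L z = L (z.1, 0) + L (0, z.2) := by
          rw [← map_add]
          simp
        rw [h3, zero_dotProduct] at h2
        rw [hA, h5, dotProduct_add]
        change ζ.1.1 (D.1 z.1 + Θ z.2) + _ = 0
        rw [map_add]
        linarith
      have h6 : ∀ y d, ζ.1.1 y + ζ.1.2 ⬝ᵥ d = 0 := fun y d => by
        have := h1 (A.symm (y, d))
        rwa [A.apply_symm_apply] at this
      apply Subtype.ext
      refine Prod.ext ?_ ?_
      · ext y
        simpa using h6 y 0
      · funext m
        simpa using h6 0 (Pi.single m 1)
    · intro a
      -- The functional `ψ(x, u) = ⟨a, u⟩` vanishes on `X`, so its preimage under the transpose of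
      -- `A` lies in the kernel, and its coordinates are `a`.
      let ψ : StrongDual ℝ (X × (Fin N → ℝ)) := LinearMap.toContinuousLinearMap
        (dotProductBilin ℝ ℝ a) ∘L ContinuousLinearMap.snd ℝ X (Fin N → ℝ)
      refine ⟨⟨transposeInv A ψ, ?_⟩, ?_⟩
      · ext x
        refine (stab_dual_transposeInv hA ψ x).trans ?_
        exact dotProduct_zero a
      · refine dotProduct_eq _ _ fun u => ?_
        refine (dualCoords_dotProduct Θ L (transposeInv A ψ) u).trans ?_
        have h := transposeInv_apply A ψ (0, u)
        rw [hA, Fred.stab_apply, map_zero, zero_add] at h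
        exact h)

end Fredholm

/-! ### Continuity of dualization in charts. -/

theorem map_eq_of_smul_eq {M M' : Type*} [AddCommGroup M] [Module ℝ M] [AddCommGroup M']
    [Module ℝ M'] (f : M ≃ₗ[ℝ] M') {x v : M} {x' v' : M'} {a b s : ℝ} (hx : x = b • v)
    (hv : f v = s • v') (hx' : x' = a • v') (h : a = b * s) : f x = x' := by
  rw [hx, map_smul, hv, hx', smul_smul, h]

section Fredholm

variable {X Y : Type*} [NormedAddCommGroup X] [NormedSpace ℝ X] [NormedAddCommGroup Y]
  [NormedSpace ℝ Y]

section

variable {N k : ℕ} {D : Fred X Y} {Θ : (Fin N → ℝ) →L[ℝ] Y}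
  {L : X × (Fin N → ℝ) →L[ℝ] (Fin k → ℝ)}
  {A : (X × (Fin N → ℝ)) ≃L[ℝ] (Y × (Fin k → ℝ))}

/-- Dualization in terms of the frames of `κ(D_Θ)` and of the kernel of the stabilized transpose
which are given by an extension of `D_Θ` to an isomorphism. -/
theorem dualIso_stabTop (hA : ∀ z, A z = ((D.stab Θ).1 z, L z))
    (h : Function.Surjective (D.stab Θ).1)
    (h' : Function.Surjective (D.dual.stab (dualFamily L)).1)
    (hk : Module.finrank ℝ (D.stab Θ).Ker = k)
    (hN : Module.finrank ℝ (D.dual.stab (dualFamily L)).Ker = N) :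
    dualIso D (stabTop h (topOf hk (Module.Basis.ofEquivFun (kerCoords hA)))) =
      (-1 : ℝ) ^ (((k : ℤ) - N) * (k - N - 1) / 2) •
        stabTop h' (topOf hN (Module.Basis.ofEquivFun (dualKerCoords hA))) := by
  obtain ⟨p, hp⟩ : ∃ p, Module.finrank ℝ D.Ker = p := ⟨_, rfl⟩
  obtain ⟨q, hq⟩ : ∃ q, Module.finrank ℝ D.Coker = q := ⟨_, rfl⟩
  obtain ⟨r, hr⟩ : ∃ r, Module.finrank ℝ (D.toCoker Θ).ker = r := ⟨_, rfl⟩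
  have h1 : r + q = N := by
    have := (Fred.shortExact_coker h).finrank_eq
    rwa [hr, hq, Module.finrank_fin_fun] at this
  have h2 : r + p = k := by
    have := (D.shortExact_ker Θ).finrank_eq
    rw [hr, hp, hk] at this
    omega
  subst h1 h2
  have h3 : ((r + p : ℕ) : ℤ) - (r + q : ℕ) = p - q := by
    push_cast
    ring
  rw [h3]
  exact dualIso_stabTop_aux h h' hp hq hr hk hN (kerCoords hA) (fun _ => rfl) (dualKerCoords hA)
    (fun ζ u => dualCoords_dotProduct Θ L ζ.1 u)

/-- The chart of `det_{Y*,X*}` associated with an extension of `D_Θ` to an isomorphism. -/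
noncomputable def dualChart (hA : ∀ z, A z = ((D.stab Θ).1 z, L z)) :
    Chart (StrongDual ℝ Y) (StrongDual ℝ X) where
  N := k
  Θ := dualFamily L
  E₀ := D.dual.stab (dualFamily L)
  T := transposeInv A ∘L
    ContinuousLinearMap.precomp ℝ (ContinuousLinearMap.fst ℝ X (Fin N → ℝ))
  rightInv ξ := by
    ext x
    exact stab_dual_transposeInv hA _ x

/-- The chart is centred at `D*`: its `E₀` is the stabilization of `D*` itself, so the shear is `T
E₀ + (1 - T E₀) = 1`. -/
theorem dual_mem_dualChart_dom (hA : ∀ z, A z = ((D.stab Θ).1 z, L z)) :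
    D.dual ∈ (dualChart hA).dom := by
  rw [Chart.mem_dom_iff]
  have h : (dualChart hA).shear D.dual = 1 := by
    apply ContinuousLinearMap.ext
    intro z
    rw [Chart.shear_apply]
    exact add_sub_cancel _ _
  rw [h]
  exact isUnit_one

end

/-- Near a point of its domain, the operators `D_Θ` of a chart extend to isomorphisms. -/
theorem Chart.exists_extension [CompleteSpace X] [CompleteSpace Y] (c : Chart X Y) {k : ℕ}
    (hk : Module.finrank ℝ c.E₀.Ker = k) (D : c.dom) :
    ∃ (L : X × (Fin c.N → ℝ) →L[ℝ] (Fin k → ℝ))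
      (A : (X × (Fin c.N → ℝ)) ≃L[ℝ] (Y × (Fin k → ℝ))),
      ∀ z, A z = ((D.1.stab c.Θ).1 z, L z) := by
  -- A continuous projection `R` onto the finite-dimensional kernel extends the coordinates of
  -- `κ(D_Θ)` to all of `X ⊕ ℝᴺ`.
  obtain ⟨R, hR⟩ := Submodule.ClosedComplemented.of_finiteDimensional (𝕜 := ℝ)
    (D.1.stab c.Θ).1.ker
  let e : (D.1.stab c.Θ).Ker ≃ₗ[ℝ] (Fin k → ℝ) :=
    (c.kerEquiv D).trans (Module.finBasisOfFinrankEq ℝ c.E₀.Ker hk).equivFun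
  let L : X × (Fin c.N → ℝ) →L[ℝ] (Fin k → ℝ) := LinearMap.toContinuousLinearMap e.toLinearMap ∘L R
  have hL : ∀ z : (D.1.stab c.Θ).Ker, L z = e z := fun z => congrArg e (hR z)
  let M := (D.1.stab c.Θ).1.prod L
  have hinj : LinearMap.ker M.toLinearMap = ⊥ := by
    rw [LinearMap.ker_eq_bot']
    intro z hz
    have h1 : (D.1.stab c.Θ).1 z = 0 := congrArg Prod.fst hz
    have h2 : e ⟨z, h1⟩ = 0 := (hL ⟨z, h1⟩).symm.trans (congrArg Prod.snd hz)
    exact congrArg Subtype.val ((map_eq_zero_iff e e.injective).1 h2)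
  have hsurj : LinearMap.range M.toLinearMap = ⊤ := by
    rw [LinearMap.range_eq_top]
    rintro ⟨y, d⟩
    obtain ⟨z, hz⟩ := D.2.1 y
    let z' := e.symm (d - L z)
    have h1 : (D.1.stab c.Θ).1 z' = 0 := z'.2
    refine ⟨z + z', Prod.ext ?_ ?_⟩
    · change (D.1.stab c.Θ).1 (z + z') = y
      rw [map_add, hz, h1, add_zero]
    · change L (z + z') = d
      rw [map_add, hL, e.apply_symm_apply, add_sub_cancel]
  exact ⟨L, ContinuousLinearEquiv.ofBijective M hinj hsurj, fun z => rfl⟩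

theorem exists_linear_coord {E : Fred X Y} (h : Function.Surjective E.1) {k : ℕ}
    (hk : Module.finrank ℝ E.Ker = k) (f : Module.Basis (Fin k) ℝ E.Ker) :
    ∃ ρ : DetLine X Y E →ₗ[ℝ] ℝ, ∀ σ, detSurj h σ = ρ σ • topOf hk f := by
  have h0 := topOf_basis_ne_zero hk f
  obtain ⟨α, hα⟩ := Module.Projective.exists_dual_eq_one ℝ h0
  refine ⟨α ∘ₗ detSurj h, fun σ => ?_⟩
  obtain ⟨a, ha⟩ := (finrank_eq_one_iff_of_nonzero' _ h0).1 finrank_top (detSurj h σ)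
  rw [LinearMap.comp_apply, ← ha, map_smul, hα, smul_eq_mul, mul_one]

/-- Dualization as a map of total spaces. -/
noncomputable def dualTotal (p : Bundle.TotalSpace ℝ (DetLine X Y)) :
    Bundle.TotalSpace ℝ (DetLine (StrongDual ℝ Y) (StrongDual ℝ X)) :=
  ⟨p.proj.dual, dualIso p.proj p.2⟩

/-- On a neighbourhood of `P₀`, dualization followed through the chart `c` is the chart `c'` applied
to a continuous scalar times a fixed vector `τ`. -/
theorem continuousAt_dualTotal_comp_map [CompleteSpace X] [CompleteSpace Y] (c : Chart X Y)
    (P₀ : c.dom × DetLine (X × (Fin c.N → ℝ)) Y c.E₀) :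
    ContinuousAt (dualTotal ∘ c.map) P₀ := by
  obtain ⟨k, hk⟩ : ∃ k, Module.finrank ℝ c.E₀.Ker = k := ⟨_, rfl⟩
  let f := Module.finBasisOfFinrankEq ℝ c.E₀.Ker hk
  obtain ⟨L, A₀, hA₀⟩ := c.exists_extension hk P₀.1
  let c' := dualChart hA₀
  have hN : Module.finrank ℝ c'.E₀.Ker = c.N :=
    (dualKerCoords hA₀).finrank_eq.trans (Module.finrank_fin_fun ℝ)
  let g := Module.finBasisOfFinrankEq ℝ c'.E₀.Ker hN
  obtain ⟨ρ, hρ⟩ := exists_linear_coord c.surjective hk f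
  obtain ⟨τ, hτ⟩ := exists_detSurj_eq c'.surjective (topOf hN g)
  -- `L` is fixed from the base point on; `W` collects the points where `(D_Θ, L)` is still
  -- invertible and `D*` still lies in the domain of `c'`.
  let W : Set (c.dom × DetLine (X × (Fin c.N → ℝ)) Y c.E₀) :=
    {P | ((P.1.1.stab c.Θ).1.prod L ∈ Set.range
      ((↑) : ((X × (Fin c.N → ℝ)) ≃L[ℝ] (Y × (Fin k → ℝ))) → _)) ∧ P.1.1.dual ∈ c'.dom}
  have hc1 : Continuous fun P : c.dom × DetLine (X × (Fin c.N → ℝ)) Y c.E₀ => P.1.1 :=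
    continuous_subtype_val.comp continuous_fst
  have hprod : Continuous fun B : (X × (Fin c.N → ℝ)) →L[ℝ] Y => B.prod L := by
    have h : (fun B : (X × (Fin c.N → ℝ)) →L[ℝ] Y => B.prod L) = fun B =>
        ContinuousLinearMap.inl ℝ Y (Fin k → ℝ) ∘L B +
          ContinuousLinearMap.inr ℝ Y (Fin k → ℝ) ∘L L := by
      funext B
      ext z <;> simp
    rw [h]
    exact (continuous_const.clm_comp continuous_id).add continuous_const
  have hW : IsOpen W := by
    refine IsOpen.inter ?_ ?_
    · exact ContinuousLinearEquiv.isOpen.preimage (hprod.comp ((continuous_stab c.Θ).comp hc1))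
    · exact c'.isOpen_dom.preimage (continuous_dual.comp hc1)
  have hP₀ : P₀ ∈ W := by
    refine ⟨⟨A₀, ?_⟩, dual_mem_dualChart_dom hA₀⟩
    apply ContinuousLinearMap.ext
    exact hA₀
  -- `G` and `G'` are the determinants between the frames transported by the charts and the frames
  -- given by `L` and by `dualCoords`.
  let G : c.dom → ℝ := fun D => (Matrix.of fun i => L ((c.kerEquiv D).symm (f i)).1).det
  let G' : c'.dom → ℝ := fun D =>
    (Matrix.of fun i => dualCoords c.Θ L ((c'.kerEquiv D).symm (g i)).1).det
  have hG : Continuous G := by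
    refine Continuous.matrix_det (continuous_pi fun i => ?_)
    exact L.continuous.comp (c.continuous_kerEquiv_symm (f i))
  have hG' : Continuous G' := by
    refine Continuous.matrix_det (continuous_pi fun i => ?_)
    exact (dualCoords c.Θ L).continuous.comp (c'.continuous_kerEquiv_symm (g i))
  have hkD : ∀ D : c.dom, Module.finrank ℝ (D.1.stab c.Θ).Ker = k := fun D =>
    (c.kerEquiv D).finrank_eq.trans hk
  have hND : ∀ D : c'.dom, Module.finrank ℝ (D.1.stab c'.Θ).Ker = c.N := fun D =>
    (c'.kerEquiv D).finrank_eq.trans hN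
  -- On `W` the dual coordinates are an isomorphism on the stabilized kernel, and the chart
  -- transports the basis `g` to a basis of it.
  have hG0 : ∀ P : W, G' ⟨_, P.2.2⟩ ≠ 0 := fun P => by
    obtain ⟨A, hA⟩ := P.2.1
    have hA' : ∀ z, A z = ((P.1.1.1.stab c.Θ).1 z, L z) := fun z =>
      congrArg (fun B : (X × (Fin c.N → ℝ)) →L[ℝ] (Y × (Fin k → ℝ)) => B z) hA
    refine det_ne_zero_of_topOf_ne_zero (hND ⟨_, P.2.2⟩) (dualKerCoords hA')
      (v := fun i => (c'.kerEquiv ⟨_, P.2.2⟩).symm (g i)) ?_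
    exact topOf_basis_ne_zero (hND ⟨_, P.2.2⟩) (g.map (c'.kerEquiv ⟨_, P.2.2⟩).symm)
  let s : ℝ := (-1 : ℝ) ^ (((k : ℤ) - c.N) * (k - c.N - 1) / 2)
  -- This scalar solves `a G' = s ρ G`, the equality of the coefficients of the two frames under
  -- dualization.
  let a : W → ℝ := fun P => s * (ρ P.1.2 * G P.1.1) / G' ⟨_, P.2.2⟩
  have hd : Continuous fun P : W => (⟨P.1.1.1.dual, P.2.2⟩ : c'.dom) :=
    Continuous.subtype_mk (continuous_dual.comp (hc1.comp continuous_subtype_val)) _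
  have ha : Continuous a := by
    refine Continuous.div (continuous_const.mul (Continuous.mul ?_ ?_)) (hG'.comp hd) hG0
    · exact (IsModuleTopology.continuous_of_linearMap ρ).comp
        (continuous_snd.comp continuous_subtype_val)
    · exact hG.comp (continuous_fst.comp continuous_subtype_val)
  have key : ∀ P : W, dualTotal (c.map P.1) = c'.map (⟨P.1.1.1.dual, P.2.2⟩, a P • τ) := fun P => by
    obtain ⟨A, hA⟩ := P.2.1
    have hA' : ∀ z, A z = ((P.1.1.1.stab c.Θ).1 z, L z) := fun z =>
      congrArg (fun B : (X × (Fin c.N → ℝ)) →L[ℝ] (Y × (Fin k → ℝ)) => B z) hA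
    have h1 := c.map_snd_eq P.1.1 hk (hkD P.1.1) f (kerCoords hA') (hρ P.1.2)
    have h2 := c'.map_snd_eq ⟨P.1.1.1.dual, P.2.2⟩ hN (hND ⟨_, P.2.2⟩) g (dualKerCoords hA')
      (a := a P) (σ := a P • τ) ((LinearMap.map_smul _ _ _).trans (congrArg _ hτ))
    have h3 := dualIso_stabTop hA' P.1.1.2.1 P.2.2.1 (hkD P.1.1) (hND ⟨_, P.2.2⟩)
    have h4 : a P * G' ⟨_, P.2.2⟩ = (ρ P.1.2 * G P.1.1) * s := by
      rw [mul_comm _ s]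
      exact div_mul_cancel₀ _ (hG0 P)
    refine congrArg (Bundle.TotalSpace.mk (P.1.1.1.dual)) ?_
    exact map_eq_of_smul_eq (dualIso P.1.1.1) h1 h3 h2 h4
  have hcont : ContinuousOn (dualTotal ∘ c.map) W := by
    rw [continuousOn_iff_continuous_domRestrict]
    have h : W.domRestrict (dualTotal ∘ c.map) =
        fun P : W => c'.map (⟨P.1.1.1.dual, P.2.2⟩, a P • τ) := funext key
    rw [h]
    exact c'.continuous_map.comp (hd.prodMk (ha.smul continuous_const))
  exact hcont.continuousAt (hW.mem_nhds hP₀)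

theorem continuous_dualTotal [CompleteSpace X] [CompleteSpace Y] :
    Continuous (dualTotal : Bundle.TotalSpace ℝ (DetLine X Y) → _) :=
  continuous_of_comp_map fun c =>
    continuous_iff_continuousAt.2 (continuousAt_dualTotal_comp_map c)

theorem continuous_proj :
    Continuous (Bundle.TotalSpace.proj : Bundle.TotalSpace ℝ (DetLine X Y) → _) :=
  continuous_of_comp_map fun _ => continuous_subtype_val.comp continuous_fst

end Fredholm

end FredDet

theorem mainTheorem9 {X Y : Type*} [NormedAddCommGroup X] [NormedSpace ℝ X] [CompleteSpace X]
    [NormedAddCommGroup Y] [NormedSpace ℝ Y] [CompleteSpace Y] :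
    Continuous (fun p : Bundle.TotalSpace ℝ (FredDet.DetLine X Y) =>
      (⟨p.proj, FredDet.dualIso p.proj p.2⟩ : Bundle.TotalSpace ℝ
        (FredDet.Fred.dual *ᵖ (FredDet.DetLine (StrongDual ℝ Y) (StrongDual ℝ X))))) := by
  -- The pullback total space has the topology induced from the product of the base and the total
  -- space of `det_{Y*,X*}`, so the two components are tested separately.
  rw [(inducing_pullbackTotalSpaceEmbedding _ _ _).continuous_iff]
  exact FredDet.continuous_proj.prodMk FredDet.continuous_dualTotal
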